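/- Let $m,n\ge 0$ be integers, $A\in\mathbb R^{m\times n}$, $b\in\mathbb R^m$, $\tilde x\in\mathbb R^n$, $\beta,\rho,\sigma>0$. Let $g(x)=\sum_{1\le i<j\le n}|x_i-x_j|$ and $p(x)=\beta\|x\|_1+\rho\, g(x)$ on $\mathbb R^n$, let $p^*$ be the Fenchel conjugate of $p$, and for $\xi\in\mathbb R^m$ let $$\psi(\xi)=\inf_{u\in\mathbb R^n}\Big\{\tfrac12\|\xi\|^2+\langle b,\xi\rangle+p^*(u)-\langle\tilde x,A^T\xi+u\rangle+\tfrac{\sigma}{2}\|A^T\xi+u\|^2\Big\}.$$ *The generalized Jacobian.* Let $B\in\mathbb R^{(n-1)\times n}$ be given by $Bx=(x_1-x_2,\dots,x_{n-1}-x_n)$, $D=\{x: Bx\ge 0\}$, $\Pi_D$ the metric projection onto $D$, and $w_k=n-2k+1$ for $k=1,\dots,n$. For $y\in\mathbb R^n$ let $\mathcal K_D(y)$ consist of the sets $K\subseteq\{1,\dots,n-1\}$ for which the rows $B_K$ of $B$ indexed by $K$ are linearly independent and there is $\lambda\le 0$ with $\Pi_D(y)-y+B^T\lambda=0$, $\lambda^TB\Pi_D(y)=0$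 and $\mathrm{supp}(\lambda)\subseteq K\subseteq\{i: (B\Pi_D(y))_i=0\}$. Put $\mathcal Q_D(y)=\{I_n-B_K^T(B_KB_K^T)^{-1}B_K: K\in\mathcal K_D(y)\}$. Let $S_\rho(y)=\mathrm{argmin}_x\{\frac12\|x-y\|^2+\rho g(x)\}$, and let $\mathcal Q_{S_\rho}(y)$ be the set of all $P^T\widehat QP$ with $P$ a permutation matrix such that $Py$ is nonincreasing and $\widehat Q\in\mathcal Q_D(Py-\rho w)$. Let $\mathcal M(y)$ be the set of symmetric matrices of the form $\Theta Q$ with $Q\in\mathcal Q_{S_\rho}(y)$ and $\Theta=\mathrm{Diag}(q)$, where, with $\eta=S_\rho(y)$, $q_i=0$ if $|\eta_i|<\beta$, $q_i\in\{0,1\}$ if $|\eta_i|=\beta$, and $q_i=1$ if $|\eta_i|>\beta$. Finally let $$\mathcal V(\xi)=\{I_m+\sigma AMA^T:\ M\in\mathcal M(\tilde x/\sigma-A^T\xi)\}.$$ *The algorithm.* Let $\mu\in(0,1/2)$, $\bar\eta\in(0,1)$, $\tau\in(0,1]$, $\delta\in(0,1)$, $\xi^0\in\mathbb R^m$. The semismooth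 Newton method generates $\{\xi^j\}_{j\ge0}$ as follows: choose any $V_j\in\mathcal V(\xi^j)$; let $h^j$ be either the exact solution of $V_jh=-\nabla\psi(\xi^j)$ or an iterate of the conjugate gradient method for this system started at $0$, such that $$\|V_jh^j+\nabla\psi(\xi^j)\|\le\min(\bar\eta,\|\nabla\psi(\xi^j)\|^{1+\tau});$$ let $m_j$ be the smallest integer $k\ge0$ with $\psi(\xi^j+\delta^{k}h^j)\le\psi(\xi^j)+\mu\delta^{k}\langle\nabla\psi(\xi^j),h^j\rangle$; put $\xi^{j+1}=\xi^j+\delta^{m_j}h^j$. **Theorem.** The function $\psi$ is (finite and) continuously differentiable, and it has a unique minimizer $\hat\xi$, which is the only solution of $\nabla\psi(\xi)=0$. Every infinite sequence $\{\xi^j\}$ generated by the algorithm converges to $\hat\xi$ and satisfies $\|\xi^{j+1}-\hat\xi\|=O(\|\xi^j-\hat\xi\|^{1+\tau})$ as $j\to\infty$. Moreover, the unit step is eventually accepted: there is $j_0$ such that $m_j=0$, and hence $\xi^{j+1}=\xi^j+h^j$, for all $j\ge j_0$. -/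

import Mathlib

open Filter Topology
open scoped InnerProductSpace

noncomputable section

namespace ClusteredLasso

/-- Euclidean space `ℝᵏ` with its Euclidean norm and inner product. -/
abbrev Vec (k : ℕ) : Type := EuclideanSpace ℝ (Fin k)

/-- The matrix-vector product `C v` on Euclidean spaces. -/
def app {k l : ℕ} (C : Matrix (Fin k) (Fin l) ℝ) (v : Vec l) : Vec k :=
  WithLp.toLp 2 (C.mulVec v)

/-- The minimizer of `f` over `S` (used only where it exists and is unique). -/
def argminOn {k : ℕ} (f : Vec k → ℝ) (S : Set (Vec k)) : Vec k :=
  Classical.epsilon fun x => x ∈ S ∧ ∀ z ∈ S, f x ≤ f z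

/-! ### The regularizer, the dual problem, and the subproblem -/

/-- `g(x) = ∑_{i<j} |x_i - x_j|`. -/
def pairDiff {n : ℕ} (x : Vec n) : ℝ :=
  ∑ i, ∑ j ∈ Finset.Ioi i, |x i - x j|

/-- The clustered lasso regularizer `p(x) = β ‖x‖₁ + ρ ∑_{i<j} |x_i - x_j|`. -/
def reg {n : ℕ} (β ρ : ℝ) (x : Vec n) : ℝ :=
  β * ∑ i, |x i| + ρ * pairDiff x

/-- The Fenchel conjugate `f^*(u) = sup_x (⟨u, x⟩ - f x)`, with extended real values. -/
def conj {n : ℕ} (f : Vec n → ℝ) (u : Vec n) : EReal :=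
  ⨆ x : Vec n, ((⟪u, x⟫_ℝ - f x : ℝ) : EReal)

/-- The Lagrangian
`l(ξ, u; x) = ½ ‖ξ‖² + ⟨b, ξ⟩ + p^*(u) - ⟨x, Aᵀ ξ + u⟩` of the dual problem. -/
def lagrangian {m n : ℕ} (A : Matrix (Fin m) (Fin n) ℝ) (b : Vec m) (β ρ : ℝ)
    (ξ : Vec m) (u x : Vec n) : EReal :=
  ((1 / 2 * ‖ξ‖ ^ 2 + ⟪b, ξ⟫_ℝ - ⟪x, app A.transpose ξ + u⟫_ℝ : ℝ) : EReal)
    + conj (reg β ρ) u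

/-- The augmented Lagrangian `L_σ(ξ, u; x) = l(ξ, u; x) + (σ/2) ‖Aᵀ ξ + u‖²`. -/
def augLagrangian {m n : ℕ} (A : Matrix (Fin m) (Fin n) ℝ) (b : Vec m) (β ρ σ : ℝ)
    (ξ : Vec m) (u x : Vec n) : EReal :=
  lagrangian A b β ρ ξ u x + ((σ / 2 * ‖app A.transpose ξ + u‖ ^ 2 : ℝ) : EReal)

/-- The subproblem objective `ψ(ξ) = inf_u L_σ(ξ, u; x̃)`. The infimum is finite
(`coe_psi`), so that nothing is lost in passing to a real number. -/
def psi {m n : ℕ} (A : Matrix (Fin m) (Fin n) ℝ) (b : Vec m) (β ρ σ : ℝ) (xt : Vec n)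
    (ξ : Vec m) : ℝ :=
  (⨅ u : Vec n, augLagrangian A b β ρ σ ξ u xt).toReal

/-- The infimum defining `ψ` is a real number. -/
theorem coe_psi {m n : ℕ} (A : Matrix (Fin m) (Fin n) ℝ) (b : Vec m) {β ρ σ : ℝ}
    (hβ : 0 < β) (hρ : 0 < ρ) (hσ : 0 < σ) (xt : Vec n) (ξ : Vec m) :
    ((psi A b β ρ σ xt ξ : ℝ) : EReal) = ⨅ u : Vec n, augLagrangian A b β ρ σ ξ u xt := by
  have hreg : ∀ x : Vec n, 0 ≤ reg β ρ x := fun x => by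
    unfold reg pairDiff
    positivity
  have hconj : ∀ u : Vec n, (0 : EReal) ≤ conj (reg β ρ) u := fun u => by
    refine le_iSup_of_le (0 : Vec n) ?_
    simp [reg, pairDiff]
  have hconj0 : conj (reg β ρ) (0 : Vec n) ≤ 0 := by
    refine iSup_le fun x => ?_
    have h := hreg x
    rw [inner_zero_left, zero_sub]
    exact_mod_cast neg_nonpos.mpr h
  unfold psi
  refine EReal.coe_toReal ?_ ?_
  · refine ne_top_of_le_ne_top ?_ (iInf_le _ (0 : Vec n))
    unfold augLagrangian lagrangian
    rw [le_antisymm hconj0 (hconj 0), add_zero, ← EReal.coe_add]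
    exact EReal.coe_ne_top _
  · refine ne_bot_of_le_ne_bot
      (b := ((1 / 2 * ‖ξ‖ ^ 2 + ⟪b, ξ⟫_ℝ - ‖xt‖ ^ 2 / (2 * σ) : ℝ) : EReal))
      (EReal.coe_ne_bot _) (le_iInf fun u => ?_)
    unfold augLagrangian lagrangian
    set v := app A.transpose ξ + u
    have h1 : ⟪xt, v⟫_ℝ ≤ ‖xt‖ * ‖v‖ := real_inner_le_norm _ _
    have h2 : ‖xt‖ * ‖v‖ ≤ ‖xt‖ ^ 2 / (2 * σ) + σ / 2 * ‖v‖ ^ 2 := by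
      have h3 : ‖xt‖ ^ 2 / (2 * σ) + σ / 2 * ‖v‖ ^ 2 - ‖xt‖ * ‖v‖
          = (‖xt‖ - σ * ‖v‖) ^ 2 / (2 * σ) := by
        field_simp
        ring
      have h4 : 0 ≤ (‖xt‖ - σ * ‖v‖) ^ 2 / (2 * σ) := by positivity
      linarith
    have h5 : ((1 / 2 * ‖ξ‖ ^ 2 + ⟪b, ξ⟫_ℝ - ⟪xt, v⟫_ℝ : ℝ) : EReal)
        ≤ ((1 / 2 * ‖ξ‖ ^ 2 + ⟪b, ξ⟫_ℝ - ⟪xt, v⟫_ℝ : ℝ) : EReal) + conj (reg β ρ) u := by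
      exact le_add_of_nonneg_right (hconj u)
    refine le_trans ?_ (add_le_add_left h5 _)
    rw [← EReal.coe_add]
    exact EReal.coe_le_coe_iff.mpr (by linarith)

/-! ### The generalized Jacobian of the proximal mapping of the regularizer -/

/-- `S_ρ(y) = argmin_x { ½ ‖x - y‖² + ρ ∑_{i<j} |x_i - x_j| }`. -/
def proxPair {n : ℕ} (ρ : ℝ) (y : Vec n) : Vec n :=
  argminOn (fun x => 1 / 2 * ‖x - y‖ ^ 2 + ρ * pairDiff x) Set.univ

/-- The matrix `B` with `B x = (x₁ - x₂, …, x_{n-1} - x_n)`. -/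
def diffMat (n : ℕ) : Matrix (Fin (n - 1)) (Fin n) ℝ :=
  Matrix.of fun i j => if j.val = i.val then 1 else if j.val = i.val + 1 then -1 else 0

/-- The cone `D = {x | B x ≥ 0}` of nonincreasing vectors. -/
def coneD (n : ℕ) : Set (Vec n) := {x | ∀ i, 0 ≤ app (diffMat n) x i}

/-- The metric projection `Π_D`. -/
def projD {n : ℕ} (y : Vec n) : Vec n :=
  argminOn (fun x => 1 / 2 * ‖x - y‖ ^ 2) (coneD n)

/-- The set of multipliers `λ` in the KKT system of the projection of `y` onto `D`:
`Π_D(y) - y + Bᵀ λ = 0`, `B Π_D(y) ≥ 0`, `λ ≤ 0`, `λᵀ B Π_D(y) = 0`. -/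
def multipliers {n : ℕ} (y : Vec n) : Set (Vec (n - 1)) :=
  {l | projD y - y + app (diffMat n).transpose l = 0 ∧
    (∀ i, 0 ≤ app (diffMat n) (projD y) i) ∧ (∀ i, l i ≤ 0) ∧
    ⟪l, app (diffMat n) (projD y)⟫_ℝ = 0}

/-- The submatrix `B_K` of the rows of `B` indexed by `K`. -/
def diffRows (n : ℕ) (K : Finset (Fin (n - 1))) : Matrix K (Fin n) ℝ :=
  (diffMat n).submatrix Subtype.val id

/-- The collection `K_D(y)` of index sets `K` with `supp λ ⊆ K ⊆ I_D(y)` for some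
multiplier `λ`, and `B_K` of full row rank, where `I_D(y) = {i | B_i Π_D(y) = 0}`. -/
def indexSets {n : ℕ} (y : Vec n) : Set (Finset (Fin (n - 1))) :=
  {K | ∃ l ∈ multipliers y, (∀ i, l i ≠ 0 → i ∈ K) ∧
    (∀ i ∈ K, app (diffMat n) (projD y) i = 0) ∧
    LinearIndependent ℝ (fun i : K => diffRows n K i)}

/-- The generalized HS-Jacobian
`Q_D(y) = { I - B_Kᵀ (B_K B_Kᵀ)⁻¹ B_K | K ∈ K_D(y) }` of `Π_D`. -/
def hsJac {n : ℕ} (y : Vec n) : Set (Matrix (Fin n) (Fin n) ℝ) :=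
  {Q | ∃ K ∈ indexSets y, Q = 1 - (diffRows n K).transpose *
    (diffRows n K * (diffRows n K).transpose)⁻¹ * diffRows n K}

/-- The vector `w` with `w_k = n - 2k + 1`, `k = 1, …, n`. -/
def wvec (n : ℕ) : Vec n :=
  WithLp.toLp 2 fun i => (n : ℝ) - 2 * ((i.val : ℝ) + 1) + 1

/-- The generalized Jacobian of `S_ρ` at `y`: all `Pᵀ Q̂ P` with
`Q̂ ∈ Q_D(P y - ρ w)`, where `P` is a permutation matrix for which `P y` is nonincreasing.
With ties in `y` every such `P` is allowed. -/
def jacPair {n : ℕ} (ρ : ℝ) (y : Vec n) : Set (Matrix (Fin n) (Fin n) ℝ) :=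
  {Q | ∃ π : Equiv.Perm (Fin n),
    (∀ i j, i ≤ j → app (π.permMatrix ℝ) y j ≤ app (π.permMatrix ℝ) y i) ∧
    ∃ Qh ∈ hsJac (app (π.permMatrix ℝ) y - ρ • wvec n),
      Q = (π.permMatrix ℝ).transpose * Qh * π.permMatrix ℝ}

/-- The B-subdifferential of the proximal mapping of `β ‖·‖₁` at `η`: the matrices
`Diag(q)` with `q_i = 0` if `|η_i| < β`, `q_i ∈ {0, 1}` if `|η_i| = β`, and `q_i = 1` if
`|η_i| > β`. -/
def bSubdiffSoft {n : ℕ} (β : ℝ) (η : Vec n) : Set (Matrix (Fin n) (Fin n) ℝ) :=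
  {T | ∃ q : Fin n → ℝ, T = Matrix.diagonal q ∧ ∀ i,
    (|η i| < β → q i = 0) ∧ (|η i| = β → q i = 0 ∨ q i = 1) ∧ (β < |η i| → q i = 1)}

/-- The multifunction `M(y)`: the symmetric matrices `Θ Q` with `Θ` in the B-subdifferential
of the proximal mapping of `β ‖·‖₁` at `S_ρ(y)` and `Q` in the generalized Jacobian of
`S_ρ` at `y`. -/
def jacProx {n : ℕ} (β ρ : ℝ) (y : Vec n) : Set (Matrix (Fin n) (Fin n) ℝ) :=
  {M | M.IsSymm ∧ ∃ T ∈ bSubdiffSoft β (proxPair ρ y), ∃ Q ∈ jacPair ρ y, M = T * Q}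

/-- The multifunction `V(ξ) = { I + σ A M Aᵀ | M ∈ M(x̃/σ - Aᵀ ξ) }`. -/
def jacGrad {m n : ℕ} (A : Matrix (Fin m) (Fin n) ℝ) (β ρ σ : ℝ) (xt : Vec n)
    (ξ : Vec m) : Set (Matrix (Fin m) (Fin m) ℝ) :=
  {V | ∃ M ∈ jacProx β ρ (σ⁻¹ • xt - app A.transpose ξ),
    V = 1 + σ • (A * M * A.transpose)}

/-! ### The conjugate gradient method and the semismooth Newton method -/

/-- One step of the conjugate gradient method for a system with matrix `V`, on triples
(iterate, residual, search direction). A zero residual makes the step stationary. -/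
def cgStep {m : ℕ} (V : Matrix (Fin m) (Fin m) ℝ) (s : Vec m × Vec m × Vec m) :
    Vec m × Vec m × Vec m :=
  let a : ℝ := ⟪s.2.1, s.2.1⟫_ℝ / ⟪s.2.2, app V s.2.2⟫_ℝ
  let r : Vec m := s.2.1 - a • app V s.2.2
  (s.1 + a • s.2.2, r, r + (⟪r, r⟫_ℝ / ⟪s.2.1, s.2.1⟫_ℝ) • s.2.2)

/-- The `k`-th iterate of the conjugate gradient method for `V h = c`, started at `h = 0`. -/
def cgIterate {m : ℕ} (V : Matrix (Fin m) (Fin m) ℝ) (c : Vec m) (k : ℕ) : Vec m :=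
  ((cgStep V)^[k] (0, c, c)).1

/-- The sequences `ξ` (iterates), `V` (chosen Jacobians), `h` (directions) and `e`
(line search exponents `m_j`) are produced by the semismooth Newton method for
`∇ψ(ξ) = 0` with parameters `μ, η, τ, δ`. -/
structure IsSsnRun {m n : ℕ} (A : Matrix (Fin m) (Fin n) ℝ) (b : Vec m) (β ρ σ : ℝ)
    (xt : Vec n) (μ η τ δ : ℝ) (ξ : ℕ → Vec m) (V : ℕ → Matrix (Fin m) (Fin m) ℝ)
    (h : ℕ → Vec m) (e : ℕ → ℕ) : Prop where
  jac_mem : ∀ j, V j ∈ jacGrad A β ρ σ xt (ξ j)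
  direction : ∀ j, app (V j) (h j) = -gradient (psi A b β ρ σ xt) (ξ j) ∨
    ∃ k, h j = cgIterate (V j) (-gradient (psi A b β ρ σ xt) (ξ j)) k
  residual : ∀ j, ‖app (V j) (h j) + gradient (psi A b β ρ σ xt) (ξ j)‖ ≤
    min η (‖gradient (psi A b β ρ σ xt) (ξ j)‖ ^ (1 + τ))
  lineSearch : ∀ j, IsLeast {k : ℕ | psi A b β ρ σ xt (ξ j + δ ^ k • h j) ≤
    psi A b β ρ σ xt (ξ j) +
      μ * δ ^ k * ⟪gradient (psi A b β ρ σ xt) (ξ j), h j⟫_ℝ} (e j)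
  update : ∀ j, ξ (j + 1) = ξ j + δ ^ e j • h j

end ClusteredLasso

end

/-! Since `p` is positively homogeneous, `p^*` is the indicator of the subdifferential of `p` at 0,
and the infimum over `u` can be evaluated (`psi_eq`): with y = x̃/σ - Aᵀξ, ψ(ξ) = ½‖ξ‖² + ⟨b,ξ⟩ +
(σ/2)‖prox_p(y)‖² - ‖x̃‖²/(2σ). The function ½‖prox_p‖² is convex with the 1-Lipschitz gradient
prox_p. Hence ψ is strongly convex with modulus 1 and its gradient is Lipschitz with L = 1 + σa²,
where a bounds A and Aᵀ (`psi_quadratic_lower`, `psi_quadratic_upper`). Smoothness and the unique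
minimizer follow.

Globally, each M in M(y) is an orthogonal projector, so every V in V(ξ) lies between I and L·I.
Exact solutions and nonzero CG iterates satisfy a Galerkin condition, which gives ⟨∇ψ,h⟩ ≤ -‖h‖² and
‖∇ψ‖ ≤ L‖h‖ (`direction_properties`); the line search then forces convergence
(`tendsto_of_lineSearch`).

Locally, prox_p is piecewise affine with finitely many pieces, so prox_p(y') - prox_p(y) = M(y' - y)
holds exactly for y' near y and every M in M(y') (`eventually_proxReg_sub`). The Newton
linearization at ξ̂ therefore has no remainder: V(ξ + h - ξ̂) is the residual of the inner solver,
and the rate is the tolerance imposed on it. The same exactness gives ψ(ξ) - ψ(ξ̂) = ½⟨∇ψ(ξ), ξ -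
ξ̂⟩ (`eventually_jacGrad`), so the unit step decreases ψ by nearly -½⟨∇ψ,h⟩ and passes the test
because μ < 1/2 (`superlinear_of_tendsto`). -/

namespace ClusteredLasso

/-! ### Matrices acting on Euclidean spaces -/

section App

variable {k l p : ℕ}

theorem app_apply (C : Matrix (Fin k) (Fin l) ℝ) (v : Vec l) (i : Fin k) :
    app C v i = ∑ j, C i j * v j := rfl

theorem app_eq_toEuclideanLin (C : Matrix (Fin k) (Fin l) ℝ) (v : Vec l) :
    app C v = Matrix.toEuclideanLin C v := rfl

theorem app_add (C : Matrix (Fin k) (Fin l) ℝ) (v w : Vec l) :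
    app C (v + w) = app C v + app C w := by
  simp only [app_eq_toEuclideanLin, map_add]

theorem app_sub (C : Matrix (Fin k) (Fin l) ℝ) (v w : Vec l) :
    app C (v - w) = app C v - app C w := by
  simp only [app_eq_toEuclideanLin, map_sub]

theorem app_smul (C : Matrix (Fin k) (Fin l) ℝ) (a : ℝ) (v : Vec l) :
    app C (a • v) = a • app C v := by
  simp only [app_eq_toEuclideanLin, map_smul]

theorem app_zero (C : Matrix (Fin k) (Fin l) ℝ) : app C (0 : Vec l) = 0 := by
  simp only [app_eq_toEuclideanLin, map_zero]

theorem app_one (v : Vec k) : app 1 v = v := by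
  ext i
  simp [app]

theorem app_mul (C : Matrix (Fin k) (Fin l) ℝ) (D : Matrix (Fin l) (Fin p) ℝ) (v : Vec p) :
    app (C * D) v = app C (app D v) := by
  simp [app]

theorem app_add_left (C D : Matrix (Fin k) (Fin l) ℝ) (v : Vec l) :
    app (C + D) v = app C v + app D v := by
  ext i
  simp [app, Matrix.add_mulVec]

theorem app_smul_left (a : ℝ) (C : Matrix (Fin k) (Fin l) ℝ) (v : Vec l) :
    app (a • C) v = a • app C v := by
  ext i
  simp [app, Matrix.smul_mulVec]

theorem inner_app (C : Matrix (Fin k) (Fin l) ℝ) (v : Vec l) (w : Vec k) :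
    ⟪app C v, w⟫_ℝ = ⟪v, app C.transpose w⟫_ℝ := by
  simp only [PiLp.inner_apply, app_apply, RCLike.inner_apply, conj_trivial, Finset.mul_sum,
    Finset.sum_mul, Matrix.transpose_apply]
  rw [Finset.sum_comm]
  exact Finset.sum_congr rfl fun i _ => Finset.sum_congr rfl fun j _ => by ring

theorem continuous_app (C : Matrix (Fin k) (Fin l) ℝ) : Continuous (app C) :=
  (LinearMap.toContinuousLinearMap (Matrix.toEuclideanLin C)).continuous

theorem exists_app_bound (C : Matrix (Fin k) (Fin l) ℝ) :
    ∃ a : ℝ, 0 ≤ a ∧ ∀ v, ‖app C v‖ ≤ a * ‖v‖ :=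
  ⟨_, norm_nonneg _, (LinearMap.toContinuousLinearMap (Matrix.toEuclideanLin C)).le_opNorm⟩

theorem app_permMatrix (π : Equiv.Perm (Fin k)) (v : Vec k) (i : Fin k) :
    app (π.permMatrix ℝ) v i = v (π i) := by
  simp [app, Matrix.permMatrix_mulVec]

end App

/-! ### Proximal points -/

section Prox

variable {n : ℕ} {φ : Vec n → ℝ}

/-- `x` is the proximal point of the convex function `φ` at `y`, expressed by the
inclusion `y - x ∈ ∂φ(x)`. -/
def IsProx (φ : Vec n → ℝ) (y x : Vec n) : Prop :=
  ∀ z, φ x + ⟪y - x, z - x⟫_ℝ ≤ φ z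

theorem half_norm_sub_sq (x y z : Vec n) :
    1 / 2 * ‖z - y‖ ^ 2 = 1 / 2 * ‖x - y‖ ^ 2 - ⟪y - x, z - x⟫_ℝ + 1 / 2 * ‖z - x‖ ^ 2 := by
  have h : z - y = (z - x) - (y - x) := by abel
  rw [h, norm_sub_sq_real, norm_sub_rev x y, real_inner_comm]
  ring

theorem IsProx.add_half_le {y x : Vec n} (h : IsProx φ y x) (z : Vec n) :
    1 / 2 * ‖x - y‖ ^ 2 + φ x + 1 / 2 * ‖z - x‖ ^ 2 ≤ 1 / 2 * ‖z - y‖ ^ 2 + φ z := by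
  have := h z
  rw [half_norm_sub_sq x y z]
  linarith

/-- Firm nonexpansiveness: add the two subgradient inequalities, each tested at the other point. -/
theorem IsProx.inner_le {y x y' x' : Vec n} (h : IsProx φ y x) (h' : IsProx φ y' x') :
    ‖x' - x‖ ^ 2 ≤ ⟪y' - y, x' - x⟫_ℝ := by
  have h1 := h x'
  have h2 := h' x
  have h3 : ⟪y' - x', x - x'⟫_ℝ = -⟪y' - x', x' - x⟫_ℝ := by
    rw [← inner_neg_right, neg_sub]
  have h4 : ⟪y' - y, x' - x⟫_ℝ
      = ⟪y' - x', x' - x⟫_ℝ - ⟪y - x, x' - x⟫_ℝ + ⟪x' - x, x' - x⟫_ℝ := by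
    rw [← inner_sub_left, ← inner_add_left]
    congr 1
    abel
  rw [h4, real_inner_self_eq_norm_sq]
  linarith

theorem IsProx.norm_sub_le {y x y' x' : Vec n} (h : IsProx φ y x) (h' : IsProx φ y' x') :
    ‖x' - x‖ ≤ ‖y' - y‖ := by
  have h1 := (h.inner_le h').trans (real_inner_le_norm _ _)
  by_contra! hlt
  nlinarith [norm_nonneg (y' - y)]

theorem IsProx.unique {y x x' : Vec n} (h : IsProx φ y x) (h' : IsProx φ y x') : x' = x := by
  have := h.norm_sub_le h'
  rw [sub_self, norm_zero] at this
  exact sub_eq_zero.1 (norm_le_zero_iff.1 this)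

theorem isProx_of_forall_le (hφ : ConvexOn ℝ Set.univ φ) {y x : Vec n}
    (h : ∀ z, 1 / 2 * ‖x - y‖ ^ 2 + φ x ≤ 1 / 2 * ‖z - y‖ ^ 2 + φ z) : IsProx φ y x := by
  intro z
  by_contra! hlt
  set d := φ x + ⟪y - x, z - x⟫_ℝ - φ z with hd
  have hd0 : 0 < d := by linarith
  have key : ∀ t : ℝ, 0 < t → t ≤ 1 → d ≤ t * (1 / 2 * ‖z - x‖ ^ 2) := by
    intro t ht ht1
    have h1 := h ((1 - t) • x + t • z)
    have h2 := hφ.2 (Set.mem_univ x) (Set.mem_univ z) (by linarith : 0 ≤ 1 - t) ht.le (by ring)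
    have h3 : (1 - t) • x + t • z - x = t • (z - x) := by
      rw [sub_smul, smul_sub, one_smul]; abel
    rw [half_norm_sub_sq x y ((1 - t) • x + t • z), h3, inner_smul_right, norm_smul,
      Real.norm_of_nonneg ht.le] at h1
    simp only [smul_eq_mul] at h2
    have h4 : t * d ≤ t * (t * (1 / 2 * ‖z - x‖ ^ 2)) := by rw [hd]; nlinarith
    exact le_of_mul_le_mul_left h4 ht
  set q := 1 / 2 * ‖z - x‖ ^ 2 with hq
  have hq0 : 0 ≤ q := by positivity
  have hdq : d ≤ q := by simpa using key 1 one_pos le_rfl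
  have hq1 : 0 < q := lt_of_lt_of_le hd0 hdq
  -- Comparison along the segment from x to z gives d ≤ t·q for all t in (0,1]; this t yields d ≤
  -- d/2.
  have := key (d / (2 * q)) (by positivity) (by rw [div_le_one (by positivity)]; linarith)
  have h5 : d / (2 * q) * q = d / 2 := by field_simp
  rw [h5] at this
  linarith

theorem exists_isProx (hφ : ConvexOn ℝ Set.univ φ) (h0 : ∀ x, 0 ≤ φ x) (y : Vec n) :
    ∃ x, IsProx φ y x := by
  have hc : Continuous φ := continuousOn_univ.1 (hφ.continuousOn isOpen_univ)
  have hlim : Tendsto (fun x : Vec n => 1 / 2 * ‖x - y‖ ^ 2 + φ x) (cocompact _) atTop := by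
    refine tendsto_atTop_mono (fun x => le_add_of_nonneg_right (h0 x)) ?_
    refine Tendsto.const_mul_atTop (by norm_num) ?_
    refine (tendsto_pow_atTop two_ne_zero).comp ?_
    refine tendsto_atTop_mono (f := fun x : Vec n => ‖x‖ - ‖y‖) (fun x => norm_sub_norm_le _ _) ?_
    exact tendsto_atTop_add_const_right _ _ (tendsto_norm_cocompact_atTop)
  obtain ⟨x, hx⟩ := Continuous.exists_forall_le (by fun_prop) hlim
  exact ⟨x, isProx_of_forall_le hφ hx⟩

theorem IsProx.argminOn_eq {y x : Vec n} (h : IsProx φ y x) :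
    argminOn (fun x => 1 / 2 * ‖x - y‖ ^ 2 + φ x) Set.univ = x := by
  have hex : ∃ x, x ∈ Set.univ ∧ ∀ z ∈ Set.univ,
      1 / 2 * ‖x - y‖ ^ 2 + φ x ≤ 1 / 2 * ‖z - y‖ ^ 2 + φ z :=
    ⟨x, Set.mem_univ _, fun z _ => by have := h.add_half_le z; nlinarith [sq_nonneg ‖z - x‖]⟩
  have h1 := (Classical.epsilon_spec hex).2 x (Set.mem_univ _)
  have h2 := h.add_half_le (argminOn (fun x => 1 / 2 * ‖x - y‖ ^ 2 + φ x) Set.univ)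
  have h3 : ‖argminOn (fun x => 1 / 2 * ‖x - y‖ ^ 2 + φ x) Set.univ - x‖ ^ 2 ≤ 0 := by
    unfold argminOn at *
    linarith
  exact sub_eq_zero.1 (norm_eq_zero.1 (pow_eq_zero_iff two_ne_zero |>.1
    (le_antisymm h3 (sq_nonneg _))))

/-- Test the subgradient inequality at 0 and at 2x; of homogeneity only scaling by 2 is needed. -/
theorem IsProx.inner_eq (h2 : ∀ x, φ ((2 : ℝ) • x) = 2 * φ x) {y x : Vec n}
    (h : IsProx φ y x) : ⟪y - x, x⟫_ℝ = φ x := by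
  have h0 : φ 0 = 0 := by
    have := h2 0
    rw [smul_zero] at this
    linarith
  have ha := h 0
  have hb := h ((2 : ℝ) • x)
  rw [h0, zero_sub, inner_neg_right] at ha
  rw [h2, two_smul, add_sub_cancel_right] at hb
  linarith

theorem IsProx.inner_le_apply (h2 : ∀ x, φ ((2 : ℝ) • x) = 2 * φ x) {y x : Vec n}
    (h : IsProx φ y x) (z : Vec n) : ⟪y - x, z⟫_ℝ ≤ φ z := by
  have := h z
  rw [inner_sub_right, h.inner_eq h2] at this
  linarith

theorem isProx_of_inner_eq {y x : Vec n} (h1 : ⟪y - x, x⟫_ℝ = φ x)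
    (h2 : ∀ z, ⟪y - x, z⟫_ℝ ≤ φ z) : IsProx φ y x := fun z => by
  rw [inner_sub_right, h1]
  linarith [h2 z]

end Prox

/-! ### The function `g` -/

section PairDiff

variable {n : ℕ}

theorem pairDiff_nonneg (x : Vec n) : 0 ≤ pairDiff x :=
  Finset.sum_nonneg fun _ _ => Finset.sum_nonneg fun _ _ => abs_nonneg _

theorem pairDiff_smul (a : ℝ) (x : Vec n) : pairDiff (a • x) = |a| * pairDiff x := by
  simp only [pairDiff, Finset.mul_sum, PiLp.smul_apply, smul_eq_mul, ← mul_sub, abs_mul]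

theorem pairDiff_add_le (x z : Vec n) : pairDiff (x + z) ≤ pairDiff x + pairDiff z := by
  simp only [pairDiff, ← Finset.sum_add_distrib]
  refine Finset.sum_le_sum fun i _ => Finset.sum_le_sum fun j _ => ?_
  rw [PiLp.add_apply, PiLp.add_apply, add_sub_add_comm]
  exact abs_add_le _ _

theorem convexOn_pairDiff : ConvexOn ℝ Set.univ (pairDiff (n := n)) := by
  refine ⟨convex_univ, fun x _ z _ a c ha hc _ => (pairDiff_add_le _ _).trans_eq ?_⟩
  rw [pairDiff_smul, pairDiff_smul, abs_of_nonneg ha, abs_of_nonneg hc, smul_eq_mul, smul_eq_mul]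

/-- The symmetric form of `g`, from which permutation invariance is immediate. -/
theorem two_mul_pairDiff (x : Vec n) : 2 * pairDiff x = ∑ i, ∑ j, |x i - x j| := by
  have h := Finset.sum_sum_Ioi_add_eq_sum_sum_off_diag (fun i j : Fin n => |x i - x j|)
  have h1 : ∀ i, ∑ j ∈ ({i}ᶜ : Finset (Fin n)), |x j - x i| = ∑ j, |x i - x j| := fun i => by
    rw [← Finset.sum_add_sum_compl {i} (fun j => |x i - x j|)]
    simp [abs_sub_comm]
  simp only [h1] at h
  rw [← h, pairDiff, Finset.mul_sum]
  refine Finset.sum_congr rfl fun i _ => ?_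
  rw [Finset.mul_sum]
  refine Finset.sum_congr rfl fun j _ => ?_
  rw [abs_sub_comm (x j) (x i), two_mul]

theorem pairDiff_perm (π : Equiv.Perm (Fin n)) (x : Vec n) :
    pairDiff (app (π.permMatrix ℝ) x) = pairDiff x := by
  have h := two_mul_pairDiff (app (π.permMatrix ℝ) x)
  simp only [app_permMatrix] at h
  rw [Equiv.sum_comp π (fun i => ∑ j, |x i - x (π j)|)] at h
  simp only [fun i => Equiv.sum_comp π (fun j => |x i - x j|)] at h
  rw [← two_mul_pairDiff] at h
  linarith

theorem inner_perm (π : Equiv.Perm (Fin n)) (x z : Vec n) :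
    ⟪app (π.permMatrix ℝ) x, app (π.permMatrix ℝ) z⟫_ℝ = ⟪x, z⟫_ℝ := by
  simp only [PiLp.inner_apply, app_permMatrix]
  exact Equiv.sum_comp π (fun i => ⟪x i, z i⟫_ℝ)

theorem norm_perm (π : Equiv.Perm (Fin n)) (x : Vec n) : ‖app (π.permMatrix ℝ) x‖ = ‖x‖ := by
  rw [← sq_eq_sq₀ (norm_nonneg _) (norm_nonneg _), ← real_inner_self_eq_norm_sq,
    ← real_inner_self_eq_norm_sq, inner_perm]

theorem app_perm_app_transpose (π : Equiv.Perm (Fin n)) (x : Vec n) :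
    app (π.permMatrix ℝ) (app (π.permMatrix ℝ).transpose x) = x := by
  ext i
  simp [app_permMatrix]

theorem app_transpose_app_perm (π : Equiv.Perm (Fin n)) (x : Vec n) :
    app (π.permMatrix ℝ).transpose (app (π.permMatrix ℝ) x) = x := by
  ext i
  simp [app_permMatrix]

/-- With indices from 0, `x i` occurs n-1-i times with a plus and i times with a minus. -/
theorem inner_wvec (x : Vec n) : ⟪wvec n, x⟫_ℝ = ∑ i, ∑ j ∈ Finset.Ioi i, (x i - x j) := by
  simp only [Finset.sum_sub_distrib]
  have h : ∑ i, ∑ j ∈ Finset.Ioi i, x j = ∑ j : Fin n, ∑ _i ∈ Finset.Iio j, x j :=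
    Finset.sum_comm' (by simp)
  rw [h, ← Finset.sum_sub_distrib, PiLp.inner_apply]
  refine Finset.sum_congr rfl fun i _ => ?_
  have h1 : ((n - 1 - i.val : ℕ) : ℝ) = n - 1 - i.val := by
    have := i.isLt
    rw [Nat.cast_sub (by omega), Nat.cast_sub (by omega)]
    simp
  simp only [Finset.sum_const, Fin.card_Ioi, Fin.card_Iio, nsmul_eq_mul, h1, wvec,
    RCLike.inner_apply, conj_trivial]
  ring

theorem pairDiff_eq_inner_wvec {x : Vec n} (hx : ∀ i j, i ≤ j → x j ≤ x i) :
    pairDiff x = ⟪wvec n, x⟫_ℝ := by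
  rw [inner_wvec]
  exact Finset.sum_congr rfl fun i _ => Finset.sum_congr rfl fun j hj =>
    abs_of_nonneg (sub_nonneg.2 (hx i j (Finset.mem_Ioi.1 hj).le))

theorem exists_perm_antitone (x : Vec n) :
    ∃ π : Equiv.Perm (Fin n), ∀ i j, i ≤ j → x (π j) ≤ x (π i) := by
  refine ⟨Tuple.sort (fun i => -x i), fun i j hij => ?_⟩
  have := Tuple.monotone_sort (fun i => -x i) hij
  simpa using this

/-- The rearrangement inequality. -/
theorem inner_le_inner_perm {v x : Vec n} (hv : ∀ i j, i ≤ j → v j ≤ v i)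
    {π : Equiv.Perm (Fin n)} (hπ : ∀ i j, i ≤ j → x (π j) ≤ x (π i)) :
    ⟪v, x⟫_ℝ ≤ ⟪v, app (π.permMatrix ℝ) x⟫_ℝ := by
  have hm : Monovary (fun i => v i) (fun i => x (π i)) :=
    Antitone.monovary (fun i j h => hv i j h) (fun i j h => hπ i j h)
  have := hm.sum_mul_comp_perm_le_sum_mul (σ := π.symm)
  simp only [Equiv.apply_symm_apply] at this
  simpa only [PiLp.inner_apply, app_permMatrix, RCLike.inner_apply, conj_trivial, mul_comm]
    using this

end PairDiff

/-! ### The proximal mapping of `ρ g` and the projection onto `D` -/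

section ProxPair

variable {n : ℕ} {ρ : ℝ}

theorem isProx_proxPair (hρ : 0 ≤ ρ) (y : Vec n) :
    IsProx (fun x => ρ * pairDiff x) y (proxPair ρ y) := by
  obtain ⟨x, hx⟩ := exists_isProx (φ := fun x : Vec n => ρ * pairDiff x)
    (by simpa using convexOn_pairDiff.smul hρ) (fun x => mul_nonneg hρ (pairDiff_nonneg x)) y
  rwa [proxPair, hx.argminOn_eq]

theorem continuous_proxPair (hρ : 0 ≤ ρ) : Continuous (proxPair (n := n) ρ) := by
  refine LipschitzWith.continuous (K := 1) (LipschitzWith.of_dist_le_mul fun y y' => ?_)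
  rw [dist_eq_norm, dist_eq_norm, NNReal.coe_one, one_mul]
  exact (isProx_proxPair hρ y').norm_sub_le (isProx_proxPair hρ y)

theorem diffMat_app (x : Vec n) (i : Fin (n - 1)) :
    app (diffMat n) x i = x ⟨i, by omega⟩ - x ⟨i + 1, by omega⟩ := by
  have h : ∀ j : Fin n, diffMat n i j * x j
      = (if j = ⟨i, by omega⟩ then x j else 0) - (if j = ⟨i + 1, by omega⟩ then x j else 0) := by
    intro j
    simp only [diffMat, Matrix.of_apply, Fin.ext_iff]
    by_cases h1 : j.val = i.val
    · simp [h1]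
    · by_cases h2 : j.val = i.val + 1 <;> simp [h1, h2]
  rw [app_apply, Finset.sum_congr rfl fun j _ => h j, Finset.sum_sub_distrib]
  simp

theorem antitone_of_diffMat_nonneg {x : Vec n} (hx : ∀ i, 0 ≤ app (diffMat n) x i) :
    ∀ i j, i ≤ j → x j ≤ x i := by
  cases n with
  | zero => exact fun i => i.elim0
  | succ k =>
    have : Antitone (fun i => x i) := by
      refine Fin.antitone_iff_succ_le.2 fun i => ?_
      have := hx i
      rw [diffMat_app] at this
      exact sub_nonneg.1 this
    exact fun i j h => this h

/-- Against a sorted v, sorting a competitor preserves its norm and `g` and can only raise the inner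
product with v. On sorted vectors `g` is the linear form ⟨w, ·⟩, so completing the square leaves the
projection of v - ρw onto `D`. The multiplier itself certifies optimality, so existence of the
projection is never needed separately. -/
theorem proxPair_eq_projD (hρ : 0 ≤ ρ) {y : Vec n} {π : Equiv.Perm (Fin n)}
    (hπ : ∀ i j, i ≤ j → app (π.permMatrix ℝ) y j ≤ app (π.permMatrix ℝ) y i)
    {l : Vec (n - 1)} (hl : l ∈ multipliers (app (π.permMatrix ℝ) y - ρ • wvec n)) :
    proxPair ρ y
      = app (π.permMatrix ℝ).transpose (projD (app (π.permMatrix ℝ) y - ρ • wvec n)) := by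
  set v := app (π.permMatrix ℝ) y with hv
  set x' := projD (v - ρ • wvec n) with hx'
  obtain ⟨h1, h2, h3, h4⟩ := hl
  have hz : v - ρ • wvec n - x' = app (diffMat n).transpose l := by
    rw [← hx', sub_add_eq_add_sub, sub_eq_zero] at h1
    rw [← h1]; abel
  have expand : ∀ a c : Vec n, 1 / 2 * ‖a - c‖ ^ 2 = 1 / 2 * ‖a‖ ^ 2 - ⟪c, a⟫_ℝ + 1 / 2 * ‖c‖ ^ 2 :=
    fun a c => by rw [norm_sub_sq_real, real_inner_comm]; ring
  have key : ∀ x : Vec n, 1 / 2 * ‖x' - v‖ ^ 2 + ρ * pairDiff x'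
      ≤ 1 / 2 * ‖x - v‖ ^ 2 + ρ * pairDiff x := by
    intro x
    obtain ⟨s, hs⟩ := exists_perm_antitone x
    set xs := app (s.permMatrix ℝ) x with hxs
    have hxs' : ∀ i j, i ≤ j → xs j ≤ xs i := fun i j hij => by
      simpa only [hxs, app_permMatrix] using hs i j hij
    have a1 : ⟪v, x⟫_ℝ ≤ ⟪v, xs⟫_ℝ := inner_le_inner_perm hπ hs
    have a2 : ‖xs‖ = ‖x‖ := norm_perm s x
    have a3 : pairDiff x = ⟪wvec n, xs⟫_ℝ := by
      rw [← pairDiff_perm s x, pairDiff_eq_inner_wvec hxs']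
    have a4 : pairDiff x' = ⟪wvec n, x'⟫_ℝ :=
      pairDiff_eq_inner_wvec (antitone_of_diffMat_nonneg h2)
    have a5 := half_norm_sub_sq x' (v - ρ • wvec n) xs
    have a6 : ⟪v - ρ • wvec n - x', xs - x'⟫_ℝ ≤ 0 := by
      rw [hz, inner_app, Matrix.transpose_transpose, app_sub, inner_sub_right, h4, sub_zero,
        PiLp.inner_apply]
      refine Finset.sum_nonpos fun i _ => ?_
      rw [RCLike.inner_apply, conj_trivial, diffMat_app]
      exact mul_nonpos_of_nonneg_of_nonpos
        (sub_nonneg.2 (hxs' _ _ (by simp [Fin.le_def]))) (h3 i)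
    rw [expand, expand x', inner_sub_left, inner_sub_left, real_inner_smul_left,
      real_inner_smul_left] at a5
    rw [expand x, expand x', a3, a4]
    rw [a2] at a5
    nlinarith [sq_nonneg ‖xs - x'‖]
  have hprox : IsProx (fun x => ρ * pairDiff x) y (app (π.permMatrix ℝ).transpose x') := by
    refine isProx_of_forall_le (by simpa using convexOn_pairDiff.smul hρ) fun z => ?_
    have := key (app (π.permMatrix ℝ) z)
    rw [hv, ← app_sub, norm_perm, pairDiff_perm, ← app_perm_app_transpose π x', ← app_sub,
      norm_perm, pairDiff_perm] at this
    exact this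
  exact hprox.unique (isProx_proxPair hρ y)

end ProxPair

/-! ### The projections `I - B_Kᵀ (B_K B_Kᵀ)⁻¹ B_K` -/

section Projection

variable {n : ℕ}

/-- The matrix `I - B_Kᵀ (B_K B_Kᵀ)⁻¹ B_K`. -/
noncomputable def kerProj (n : ℕ) (K : Finset (Fin (n - 1))) : Matrix (Fin n) (Fin n) ℝ :=
  1 - (diffRows n K).transpose * (diffRows n K * (diffRows n K).transpose)⁻¹ * diffRows n K

theorem isUnit_det_mul_transpose {ι : Type*} [Fintype ι] [DecidableEq ι]
    {R : Matrix ι (Fin n) ℝ} (hR : LinearIndependent ℝ (fun i => R i)) :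
    IsUnit (R * R.transpose).det := by
  have h : (R * R.conjTranspose).PosDef :=
    Matrix.PosDef.mul_conjTranspose_self R (Matrix.vecMul_injective_iff.2 hR)
  have := h.det_pos
  rw [Matrix.conjTranspose_eq_transpose_of_trivial] at this
  exact this.ne'.isUnit

theorem kerProj_isSymm (K : Finset (Fin (n - 1))) : (kerProj n K).transpose = kerProj n K := by
  simp only [kerProj, Matrix.transpose_sub, Matrix.transpose_one, Matrix.transpose_mul,
    Matrix.transpose_transpose, Matrix.transpose_nonsing_inv, Matrix.mul_assoc]

theorem kerProj_mul_self {K : Finset (Fin (n - 1))}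
    (hK : LinearIndependent ℝ (fun i : K => diffRows n K i)) :
    kerProj n K * kerProj n K = kerProj n K := by
  have h := isUnit_det_mul_transpose hK
  unfold kerProj
  set R := diffRows n K
  set G := R * R.transpose with hG
  have h1 : R.transpose * G⁻¹ * R * (R.transpose * G⁻¹ * R) = R.transpose * G⁻¹ * R := by
    calc R.transpose * G⁻¹ * R * (R.transpose * G⁻¹ * R)
        = R.transpose * (G⁻¹ * (R * R.transpose)) * G⁻¹ * R := by simp only [Matrix.mul_assoc]
      _ = _ := by rw [← hG, Matrix.nonsing_inv_mul _ h, Matrix.mul_one]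
  rw [Matrix.sub_mul, Matrix.one_mul, Matrix.mul_sub, Matrix.mul_one, h1, sub_self, sub_zero]

theorem app_kerProj_of_eq_zero {K : Finset (Fin (n - 1))} {x : Vec n}
    (hx : ∀ i ∈ K, app (diffMat n) x i = 0) : app (kerProj n K) x = x := by
  have h : (diffRows n K).mulVec x = 0 := by
    ext i
    exact hx i i.2
  ext i
  simp [app, kerProj, Matrix.sub_mulVec, ← Matrix.mulVec_mulVec, h]

theorem app_kerProj_transpose {K : Finset (Fin (n - 1))}
    (hK : LinearIndependent ℝ (fun i : K => diffRows n K i)) {l : Vec (n - 1)}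
    (hl : ∀ i, l i ≠ 0 → i ∈ K) : app (kerProj n K) (app (diffMat n).transpose l) = 0 := by
  have h := isUnit_det_mul_transpose hK
  have h1 : app (diffMat n).transpose l
      = WithLp.toLp 2 ((diffRows n K).transpose.mulVec fun i : K => l i) := by
    ext j
    rw [app_apply]
    simp only [Matrix.mulVec, dotProduct, Matrix.transpose_apply, diffRows,
      Matrix.submatrix_apply, id]
    rw [Finset.sum_coe_sort K (fun i => diffMat n i j * l i)]
    symm
    refine Finset.sum_subset (Finset.subset_univ K) fun i _ hi => ?_
    rw [not_not.1 (mt (hl i) hi), mul_zero]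
  rw [h1]
  simp only [app, kerProj, Matrix.mulVec_mulVec, Matrix.sub_mul, Matrix.one_mul,
    Matrix.mul_assoc]
  rw [Matrix.nonsing_inv_mul _ h, Matrix.mul_one, sub_self, Matrix.zero_mulVec]
  rfl

/-- In the KKT splitting z = Π_D(z) + Bᵀλ, the projector onto ker B_K fixes the first term, since K
consists of active rows, and kills the second, since λ is supported in K. -/
theorem app_kerProj_eq_projD {K : Finset (Fin (n - 1))} {z : Vec n} (hK : K ∈ indexSets z) :
    app (kerProj n K) z = projD z := by
  obtain ⟨l, ⟨h1, -⟩, h2, h3, h4⟩ := hK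
  have hz : z = projD z + app (diffMat n).transpose l := by
    rw [sub_add_eq_add_sub, sub_eq_zero] at h1
    exact h1.symm
  nth_rewrite 1 [hz]
  rw [app_add, app_kerProj_of_eq_zero h3, app_kerProj_transpose h4 h2, add_zero]

end Projection

/-! ### Soft thresholding and the proximal mapping of the regularizer -/

section Soft

/-- The scalar soft thresholding function. -/
noncomputable def soft (β t : ℝ) : ℝ := t - max (-β) (min β t)

variable {β : ℝ}

theorem soft_of_abs_le {t : ℝ} (h : |t| ≤ β) : soft β t = 0 := by
  obtain ⟨h1, h2⟩ := abs_le.1 h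
  rw [soft, min_eq_right h2, max_eq_right h1, sub_self]

theorem soft_of_le {t : ℝ} (hβ : 0 ≤ β) (h : β ≤ t) : soft β t = t - β := by
  rw [soft, min_eq_left h, max_eq_right (by linarith)]

theorem soft_of_le_neg {t : ℝ} (hβ : 0 ≤ β) (h : t ≤ -β) : soft β t = t + β := by
  rw [soft, min_eq_right (by linarith), max_eq_left h, sub_neg_eq_add]

/-- Soft thresholding and clamping are both nondecreasing and sum to the identity, so their
increments have the same sign. -/
theorem abs_sub_eq_soft_add (s t : ℝ) : |s - t| = |soft β s - soft β t|
    + |max (-β) (min β s) - max (-β) (min β t)| := by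
  wlog h : t ≤ s generalizing s t
  · rw [abs_sub_comm, this t s (le_of_not_ge h), abs_sub_comm,
      abs_sub_comm (max (-β) (min β t))]
  have h1 : max (-β) (min β t) ≤ max (-β) (min β s) :=
    max_le_max le_rfl (min_le_min le_rfl h)
  have h2 : max (-β) (min β s) - max (-β) (min β t) ≤ s - t := by
    rw [sub_le_iff_le_add]
    refine max_le ?_ (min_le_iff.2 ?_)
    · linarith [le_max_left (-β) (min β t)]
    · by_cases hb : β ≤ t
      · left; rw [min_eq_left hb]; linarith [le_max_right (-β) β]
      · right; rw [min_eq_right (by linarith)]; linarith [le_max_right (-β) t]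
  rw [abs_of_nonneg (sub_nonneg.2 h), abs_of_nonneg (sub_nonneg.2 h1), abs_of_nonneg]
  · unfold soft; ring
  · unfold soft; linarith

/-- Says that the clamped value is a subgradient of β|·| at `soft β t`. -/
theorem clamp_mul_soft (hβ : 0 ≤ β) (t : ℝ) :
    max (-β) (min β t) * soft β t = β * |soft β t| := by
  rcases le_total β t with h | h
  · rw [soft_of_le hβ h, min_eq_left h, max_eq_right (by linarith), abs_of_nonneg (by linarith)]
  rcases le_total t (-β) with h' | h'
  · rw [soft_of_le_neg hβ h', min_eq_right h, max_eq_left h', abs_of_nonpos (by linarith)]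
    ring
  · rw [soft_of_abs_le (abs_le.2 ⟨h', h⟩)]
    simp

/-- The slope q is taken at the nearby point s, not at t. It is ambiguous only at a kink, and a kink
close to t must be t itself, where both sides vanish. -/
theorem eventually_soft_sub (hβ : 0 < β) (t : ℝ) : ∀ᶠ s in 𝓝 t, ∀ q : ℝ,
    (|s| < β → q = 0) → (|s| = β → q = 0 ∨ q = 1) → (β < |s| → q = 1) →
    soft β s - soft β t = q * (s - t) := by
  rcases lt_trichotomy |t| β with h | h | h
  · filter_upwards [continuous_abs.continuousAt.eventually (gt_mem_nhds h)] with s hs q hq _ _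
    rw [soft_of_abs_le h.le, soft_of_abs_le (le_of_lt hs), hq hs, sub_zero, zero_mul]
  · have hball : ∀ᶠ s in 𝓝 t, |s - t| < β := by
      filter_upwards [Metric.ball_mem_nhds t hβ] with s hs
      rwa [Metric.mem_ball, Real.dist_eq] at hs
    filter_upwards [hball] with s hs q h1 h2 h3
    rw [soft_of_abs_le h.le, sub_zero]
    rcases lt_trichotomy |s| β with h' | h' | h'
    · rw [soft_of_abs_le h'.le, h1 h', zero_mul]
    · have : s = t := by
        rcases eq_or_eq_neg_of_abs_eq (h'.trans h.symm) with e | e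
        · rcases abs_choice t with e' | e' <;> rcases abs_cases s with ⟨e1, -⟩ | ⟨e1, -⟩ <;>
            rw [abs_lt] at hs <;> linarith [hs.1, hs.2]
        · rcases abs_choice t with e' | e' <;> rcases abs_cases s with ⟨e1, -⟩ | ⟨e1, -⟩ <;>
            rw [abs_lt] at hs <;> linarith [hs.1, hs.2]
      rw [this, sub_self, mul_zero, soft_of_abs_le h.le]
    · rw [h3 h', one_mul]
      rw [abs_lt] at hs
      rcases (abs_eq hβ.le).1 h with e | e
      · rw [soft_of_le hβ.le, e]
        rcases lt_abs.1 h' with h' | h' <;> linarith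
      · rw [soft_of_le_neg hβ.le, e, sub_neg_eq_add]
        rcases lt_abs.1 h' with h' | h' <;> linarith
  · rcases lt_abs.1 h with h' | h'
    · filter_upwards [lt_mem_nhds h'] with s hs q _ _ h3
      rw [h3 (lt_abs.2 (Or.inl hs)), soft_of_le hβ.le hs.le, soft_of_le hβ.le h'.le]
      ring
    · have h'' : t < -β := by linarith
      filter_upwards [gt_mem_nhds h''] with s hs q _ _ h3
      rw [h3 (lt_abs.2 (Or.inr (by linarith))), soft_of_le_neg hβ.le hs.le,
        soft_of_le_neg hβ.le h''.le]
      ring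

end Soft

section ProxReg

variable {n : ℕ} {β ρ : ℝ}

/-- The proximal mapping of the regularizer. -/
noncomputable def proxReg (β ρ : ℝ) (y : Vec n) : Vec n :=
  WithLp.toLp 2 fun i => soft β (proxPair ρ y i)

theorem proxReg_apply (y : Vec n) (i : Fin n) : proxReg β ρ y i = soft β (proxPair ρ y i) := rfl

/-- Write η = S_ρ(y) = s + c with s soft-thresholded and c clamped. Then y - s = (y - η) + c, where
y - η is a subgradient of ρg not only at η but also at s, and c is a subgradient of β‖·‖₁ at s. -/
theorem isProx_proxReg (hβ : 0 ≤ β) (hρ : 0 ≤ ρ) (y : Vec n) :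
    IsProx (reg β ρ) y (proxReg β ρ y) := by
  have hη := isProx_proxPair hρ y
  have hhom : ∀ x : Vec n, ρ * pairDiff ((2 : ℝ) • x) = 2 * (ρ * pairDiff x) := fun x => by
    rw [pairDiff_smul, abs_two]; ring
  have h1 := hη.inner_eq hhom
  have h2 := hη.inner_le_apply hhom
  set η := proxPair ρ y with hηdef
  set s := proxReg β ρ y with hs
  set c : Vec n := WithLp.toLp 2 fun i => max (-β) (min β (η i)) with hc
  have hsc : η = s + c := by
    ext i
    simp [hs, proxReg_apply, hc, soft, hηdef]
  have hg : pairDiff η = pairDiff s + pairDiff c := by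
    simp only [pairDiff, ← Finset.sum_add_distrib]
    exact Finset.sum_congr rfl fun i _ => Finset.sum_congr rfl fun j _ =>
      abs_sub_eq_soft_add _ _
  -- The inequalities ⟨y - η, ·⟩ ≤ ρg at s and at c add up to an equality at η = s + c, because `g`
  -- is additive on this splitting; so each is an equality.
  have h3 : ⟪y - η, s⟫_ℝ = ρ * pairDiff s := by
    have ha := h2 s
    have hb := h2 c
    rw [hg] at h1
    nth_rewrite 2 [hsc] at h1
    rw [inner_add_right] at h1
    linarith
  have hdecomp : y - s = (y - η) + c := by rw [hsc]; abel
  refine isProx_of_inner_eq ?_ fun z => ?_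
  · rw [hdecomp, inner_add_left, h3, reg, add_comm, PiLp.inner_apply, Finset.mul_sum]
    congr 1
    refine Finset.sum_congr rfl fun i _ => ?_
    rw [RCLike.inner_apply, conj_trivial, mul_comm]
    exact clamp_mul_soft hβ _
  · rw [hdecomp, inner_add_left, reg, add_comm, PiLp.inner_apply, Finset.mul_sum]
    refine add_le_add (Finset.sum_le_sum fun i _ => ?_) (h2 z)
    rw [RCLike.inner_apply, conj_trivial]
    have : |c i| ≤ β := abs_le.2 ⟨le_max_left _ _, max_le (by linarith) (min_le_left _ _)⟩
    calc z i * c i ≤ |z i * c i| := le_abs_self _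
      _ = |c i| * |z i| := by rw [abs_mul, mul_comm]
      _ ≤ β * |z i| := mul_le_mul_of_nonneg_right this (abs_nonneg _)

theorem norm_proxReg_sub_le (hβ : 0 ≤ β) (hρ : 0 ≤ ρ) (y y' : Vec n) :
    ‖proxReg β ρ y' - proxReg β ρ y‖ ≤ ‖y' - y‖ :=
  (isProx_proxReg hβ hρ y).norm_sub_le (isProx_proxReg hβ hρ y')

theorem reg_smul (a : ℝ) (x : Vec n) : reg β ρ (a • x) = |a| * reg β ρ x := by
  simp only [reg, pairDiff_smul, PiLp.smul_apply, smul_eq_mul, abs_mul, ← Finset.mul_sum]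
  ring

/-! ### The generalized Jacobians -/

/-- Each Q is the linear part of an affine map, indexed by (π, K), that agrees with S_ρ at y. -/
theorem exists_of_mem_jacPair (hρ : 0 ≤ ρ) {y : Vec n} {Q : Matrix (Fin n) (Fin n) ℝ}
    (hQ : Q ∈ jacPair ρ y) : ∃ (π : Equiv.Perm (Fin n)) (K : Finset (Fin (n - 1))),
      Q = (π.permMatrix ℝ).transpose * kerProj n K * π.permMatrix ℝ ∧
      LinearIndependent ℝ (fun i : K => diffRows n K i) ∧
      (∀ i ∈ K, app (diffMat n) (app (π.permMatrix ℝ) (proxPair ρ y)) i = 0) ∧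
      proxPair ρ y = app (π.permMatrix ℝ).transpose
        (app (kerProj n K) (app (π.permMatrix ℝ) y - ρ • wvec n)) := by
  obtain ⟨π, hπ, Qh, ⟨K, hK, rfl⟩, rfl⟩ := hQ
  have h1 := app_kerProj_eq_projD hK
  obtain ⟨l, hl, -, h2, h3⟩ := hK
  have h4 := proxPair_eq_projD hρ hπ hl
  refine ⟨π, K, rfl, h3, ?_, ?_⟩
  · rwa [h4, app_perm_app_transpose]
  · rw [h1, h4]

/-- There are finitely many affine pieces (π, K), and each agrees with S_ρ on a closed set. A piece
that disagrees at y disagrees near y, so any piece valid at a close y' is also valid at y; subtract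
the two values. -/
theorem eventually_proxPair_sub (hρ : 0 ≤ ρ) (y : Vec n) : ∀ᶠ y' in 𝓝 y, ∀ Q ∈ jacPair ρ y',
    proxPair ρ y' - proxPair ρ y = app Q (y' - y) := by
  have key : ∀ (π : Equiv.Perm (Fin n)) (K : Finset (Fin (n - 1))), ∀ᶠ y' in 𝓝 y,
      proxPair ρ y' = app (π.permMatrix ℝ).transpose
        (app (kerProj n K) (app (π.permMatrix ℝ) y' - ρ • wvec n)) →
      proxPair ρ y = app (π.permMatrix ℝ).transpose
        (app (kerProj n K) (app (π.permMatrix ℝ) y - ρ • wvec n)) := by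
    intro π K
    have hcl : IsClosed {y' : Vec n | proxPair ρ y' = app (π.permMatrix ℝ).transpose
        (app (kerProj n K) (app (π.permMatrix ℝ) y' - ρ • wvec n))} :=
      isClosed_eq (continuous_proxPair hρ) ((continuous_app _).comp ((continuous_app _).comp
        ((continuous_app _).sub continuous_const)))
    by_cases hy : proxPair ρ y = app (π.permMatrix ℝ).transpose
        (app (kerProj n K) (app (π.permMatrix ℝ) y - ρ • wvec n))
    · exact Eventually.of_forall fun _ _ => hy
    · filter_upwards [hcl.isOpen_compl.mem_nhds hy] with y' hy' h
      exact absurd h hy'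
  filter_upwards [eventually_all.2 fun π => eventually_all.2 (key π)] with y' hy' Q hQ
  obtain ⟨π, K, rfl, -, -, h⟩ := exists_of_mem_jacPair hρ hQ
  rw [h, hy' π K h, app_mul, app_mul, ← app_sub, ← app_sub, app_sub _ y' y]
  congr 2
  abel

theorem eventually_proxReg_sub (hβ : 0 < β) (hρ : 0 ≤ ρ) (y : Vec n) :
    ∀ᶠ y' in 𝓝 y, ∀ M ∈ jacProx β ρ y',
      proxReg β ρ y' - proxReg β ρ y = app M (y' - y) := by
  have h1 : ∀ᶠ y' in 𝓝 y, ∀ i, ∀ q : ℝ, (|proxPair ρ y' i| < β → q = 0) →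
      (|proxPair ρ y' i| = β → q = 0 ∨ q = 1) → (β < |proxPair ρ y' i| → q = 1) →
      soft β (proxPair ρ y' i) - soft β (proxPair ρ y i)
        = q * (proxPair ρ y' i - proxPair ρ y i) := by
    refine eventually_all.2 fun i => ?_
    have hc : Continuous fun y' : Vec n => proxPair ρ y' i :=
      (EuclideanSpace.proj (𝕜 := ℝ) i).continuous.comp (continuous_proxPair hρ)
    exact hc.continuousAt.eventually (eventually_soft_sub hβ _)
  filter_upwards [h1, eventually_proxPair_sub hρ y] with y' hs hp M hM
  obtain ⟨-, T, ⟨q, rfl, hq⟩, Q, hQ, rfl⟩ := hM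
  rw [app_mul, ← hp Q hQ]
  ext i
  obtain ⟨q1, q2, q3⟩ := hq i
  simp only [PiLp.sub_apply, proxReg_apply, hs i (q i) q1 q2 q3, app, Matrix.mulVec_diagonal]

/-- Θ and Q are symmetric idempotents, and symmetry of ΘQ means that they commute. -/
theorem mul_self_of_mem_jacProx (hρ : 0 ≤ ρ) {y : Vec n} {M : Matrix (Fin n) (Fin n) ℝ}
    (hM : M ∈ jacProx β ρ y) : M * M = M := by
  obtain ⟨hsymm, T, ⟨q, rfl, hq⟩, Q, hQ, rfl⟩ := hM
  obtain ⟨π, K, rfl, hK, -, -⟩ := exists_of_mem_jacPair hρ hQ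
  set Q := (π.permMatrix ℝ).transpose * kerProj n K * π.permMatrix ℝ with hQd
  have hPP : π.permMatrix ℝ * (π.permMatrix ℝ).transpose = 1 := by
    rw [Matrix.transpose_permMatrix, ← Matrix.permMatrix_mul]
    simp
  have hQs : Q.transpose = Q := by
    simp only [hQd, Matrix.transpose_mul, Matrix.transpose_transpose, kerProj_isSymm,
      Matrix.mul_assoc]
  have hQQ : Q * Q = Q := by
    calc Q * Q = (π.permMatrix ℝ).transpose * kerProj n K *
          (π.permMatrix ℝ * (π.permMatrix ℝ).transpose) * kerProj n K * π.permMatrix ℝ := by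
          simp only [hQd, Matrix.mul_assoc]
      _ = (π.permMatrix ℝ).transpose * (kerProj n K * kerProj n K) * π.permMatrix ℝ := by
          rw [hPP, Matrix.mul_one]; simp only [Matrix.mul_assoc]
      _ = Q := by rw [kerProj_mul_self hK]
  have hTT : Matrix.diagonal q * Matrix.diagonal q = Matrix.diagonal q := by
    rw [Matrix.diagonal_mul_diagonal]
    congr 1
    ext i
    obtain ⟨q1, q2, q3⟩ := hq i
    have : q i = 0 ∨ q i = 1 := by
      rcases lt_trichotomy |proxPair ρ y i| β with h | h | h
      · exact Or.inl (q1 h)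
      · exact q2 h
      · exact Or.inr (q3 h)
    rcases this with h | h <;> simp [h]
  have hcomm : Q * Matrix.diagonal q = Matrix.diagonal q * Q := by
    have := hsymm.eq
    rwa [Matrix.transpose_mul, Matrix.diagonal_transpose, hQs] at this
  calc Matrix.diagonal q * Q * (Matrix.diagonal q * Q)
      = Matrix.diagonal q * (Q * Matrix.diagonal q) * Q := by simp only [Matrix.mul_assoc]
    _ = (Matrix.diagonal q * Matrix.diagonal q) * (Q * Q) := by
        rw [hcomm]; simp only [Matrix.mul_assoc]
    _ = _ := by rw [hTT, hQQ]

/-- Ties of S_ρ(y) recorded by K survive soft thresholding, so Q fixes prox_p(y); Θ deletes only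
coordinates that are already 0. -/
theorem app_proxReg_of_mem_jacProx (hρ : 0 ≤ ρ) {y : Vec n}
    {M : Matrix (Fin n) (Fin n) ℝ} (hM : M ∈ jacProx β ρ y) :
    app M (proxReg β ρ y) = proxReg β ρ y := by
  obtain ⟨-, T, ⟨q, rfl, hq⟩, Q, hQ, rfl⟩ := hM
  obtain ⟨π, K, rfl, -, hK, -⟩ := exists_of_mem_jacPair hρ hQ
  have h1 : app (kerProj n K) (app (π.permMatrix ℝ) (proxReg β ρ y))
      = app (π.permMatrix ℝ) (proxReg β ρ y) := by
    refine app_kerProj_of_eq_zero fun i hi => ?_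
    have := hK i hi
    rw [diffMat_app, app_permMatrix, app_permMatrix, sub_eq_zero] at this
    rw [diffMat_app, app_permMatrix, app_permMatrix, proxReg_apply, proxReg_apply, this, sub_self]
  rw [app_mul, app_mul, app_mul, h1, app_transpose_app_perm]
  ext i
  obtain ⟨q1, q2, q3⟩ := hq i
  simp only [app, Matrix.mulVec_diagonal, proxReg_apply]
  rcases le_or_gt |proxPair ρ y i| β with h | h
  · rw [soft_of_abs_le h, mul_zero]
  · rw [q3 h, one_mul]

end ProxReg

/-! ### The dual objective and its gradient -/

section Envelope

variable {n : ℕ} {φ : Vec n → ℝ}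

/-- The function `y ↦ ½ ‖prox_φ(y)‖²` is convex with gradient `prox_φ`. -/
theorem IsProx.le_half_sq (h2 : ∀ x, φ ((2 : ℝ) • x) = 2 * φ x) {y x y' x' : Vec n}
    (h : IsProx φ y x) (h' : IsProx φ y' x') :
    1 / 2 * ‖x‖ ^ 2 + ⟪x, y' - y⟫_ℝ ≤ 1 / 2 * ‖x'‖ ^ 2 := by
  have h1 := h.inner_eq h2
  have h3 := h'.inner_le_apply h2 x
  rw [inner_sub_left, real_inner_self_eq_norm_sq, real_inner_comm] at h1
  rw [inner_sub_left, real_inner_comm, real_inner_comm x x'] at h3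
  rw [inner_sub_right]
  have h4 := norm_sub_sq_real x' x
  rw [real_inner_comm] at h4
  nlinarith [sq_nonneg ‖x' - x‖]

/-- With v = x + (y' - y), the subgradient relations give ⟨v - x', x'⟩ ≥ 0, hence ‖x'‖ ≤ ‖v‖; expand
‖v‖². -/
theorem IsProx.half_sq_le (h2 : ∀ x, φ ((2 : ℝ) • x) = 2 * φ x) {y x y' x' : Vec n}
    (h : IsProx φ y x) (h' : IsProx φ y' x') :
    1 / 2 * ‖x'‖ ^ 2 ≤ 1 / 2 * ‖x‖ ^ 2 + ⟪x, y' - y⟫_ℝ + 1 / 2 * ‖y' - y‖ ^ 2 := by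
  have h1 := h'.inner_eq h2
  have h3 := h.inner_le_apply h2 x'
  rw [← h1] at h3
  have h4 : ⟪(y' - x') - (y - x), x'⟫_ℝ ≥ 0 := by rw [inner_sub_left]; linarith
  have h5 : (y' - x') - (y - x) = (x + (y' - y)) - x' := by abel
  rw [h5, inner_sub_left, real_inner_self_eq_norm_sq] at h4
  have h6 := norm_sub_sq_real (x + (y' - y)) x'
  have h7 := norm_add_sq_real x (y' - y)
  nlinarith [sq_nonneg ‖x + (y' - y) - x'‖]

end Envelope

section Dual

variable {m n : ℕ} (A : Matrix (Fin m) (Fin n) ℝ) (b : Vec m) {β ρ σ : ℝ} (xt : Vec n)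

/-- The point `x̃/σ - Aᵀ ξ`. -/
noncomputable def dualArg (σ : ℝ) (ξ : Vec m) : Vec n := σ⁻¹ • xt - app A.transpose ξ

/-- The gradient of `ψ`: `ξ + b - σ A prox_p(x̃/σ - Aᵀ ξ)`. -/
noncomputable def gradMap (β ρ σ : ℝ) (ξ : Vec m) : Vec m :=
  ξ + b - σ • app A (proxReg β ρ (dualArg A xt σ ξ))

theorem dualArg_sub (ξ ξ' : Vec m) :
    dualArg A xt σ ξ' - dualArg A xt σ ξ = -app A.transpose (ξ' - ξ) := by
  rw [dualArg, dualArg, app_sub]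
  abel

/-- Completing the square turns the problem in u into (σ/2)‖u - y‖² + p^*(u), which is minimized at
u = y - prox_p(y), the other half of the Moreau decomposition. -/
theorem psi_eq (hβ : 0 < β) (hρ : 0 < ρ) (hσ : 0 < σ) (ξ : Vec m) :
    psi A b β ρ σ xt ξ = 1 / 2 * ‖ξ‖ ^ 2 + ⟪b, ξ⟫_ℝ
      + σ * (1 / 2 * ‖proxReg β ρ (dualArg A xt σ ξ)‖ ^ 2) - ‖xt‖ ^ 2 / (2 * σ) := by
  have hp := isProx_proxReg hβ.le hρ.le (dualArg A xt σ ξ)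
  have h2 : ∀ x : Vec n, reg β ρ ((2 : ℝ) • x) = 2 * reg β ρ x := fun x => by
    rw [reg_smul, abs_two]
  have h1 := hp.inner_eq h2
  have h3 := hp.inner_le_apply h2
  set y := dualArg A xt σ ξ with hy
  set x := proxReg β ρ y with hx
  have expand : ∀ u : Vec n, -⟪xt, app A.transpose ξ + u⟫_ℝ
      + σ / 2 * ‖app A.transpose ξ + u‖ ^ 2 = σ / 2 * ‖u - y‖ ^ 2 - ‖xt‖ ^ 2 / (2 * σ) := by
    intro u
    have e : u - y = (app A.transpose ξ + u) - σ⁻¹ • xt := by rw [hy, dualArg]; abel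
    rw [e, norm_sub_sq_real, real_inner_smul_right, norm_smul, Real.norm_of_nonneg (by positivity),
      real_inner_comm]
    field_simp
    ring
  apply EReal.coe_injective
  rw [coe_psi A b hβ hρ hσ xt ξ]
  refine le_antisymm ?_ (le_iInf fun u => ?_)
  · have hconj : conj (reg β ρ) (y - x) ≤ 0 := by
      refine iSup_le fun z => ?_
      exact_mod_cast sub_nonpos.2 (h3 z)
    refine (iInf_le _ (y - x)).trans ?_
    unfold augLagrangian lagrangian
    refine (add_le_add_left (add_le_add_right hconj _) _).trans ?_
    rw [add_zero, ← EReal.coe_add]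
    refine EReal.coe_le_coe_iff.2 ?_
    have := expand (y - x)
    rw [show y - x - y = -x by abel, norm_neg] at this
    linarith
  -- Testing the conjugate at σx makes the lower bound a quadratic in u with minimizer y - x.
  · have hconj : ((⟪u, σ • x⟫_ℝ - reg β ρ (σ • x) : ℝ) : EReal) ≤ conj (reg β ρ) u :=
      le_iSup (fun z : Vec n => ((⟪u, z⟫_ℝ - reg β ρ z : ℝ) : EReal)) (σ • x)
    unfold augLagrangian lagrangian
    refine le_trans ?_ (add_le_add_left (add_le_add_right hconj _) _)
    rw [← EReal.coe_add, ← EReal.coe_add]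
    refine EReal.coe_le_coe_iff.2 ?_
    rw [reg_smul, abs_of_pos hσ, real_inner_smul_right, ← h1]
    have e1 := expand u
    have e2 : ‖u - y‖ ^ 2 = ‖u - (y - x)‖ ^ 2 - 2 * ⟪u - (y - x), x⟫_ℝ + ‖x‖ ^ 2 := by
      rw [← norm_sub_sq_real]
      congr 2
      abel
    rw [inner_sub_left] at e2
    have e3 : σ / 2 * ‖u - y‖ ^ 2 + σ * ⟪u, x⟫_ℝ - σ * ⟪y - x, x⟫_ℝ
        = σ / 2 * ‖u - (y - x)‖ ^ 2 + σ * (1 / 2 * ‖x‖ ^ 2) := by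
      rw [e2]; ring
    have e4 : 0 ≤ σ / 2 * ‖u - (y - x)‖ ^ 2 := by positivity
    linarith

/-- The modulus 1 comes from the term ½‖ξ‖² alone; the rest is convex. -/
theorem psi_quadratic_lower (hβ : 0 < β) (hρ : 0 < ρ) (hσ : 0 < σ) (ξ ξ' : Vec m) :
    psi A b β ρ σ xt ξ + ⟪gradMap A b xt β ρ σ ξ, ξ' - ξ⟫_ℝ + 1 / 2 * ‖ξ' - ξ‖ ^ 2
      ≤ psi A b β ρ σ xt ξ' := by
  have h := (isProx_proxReg hβ.le hρ.le (dualArg A xt σ ξ)).le_half_sq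
    (fun x => by rw [reg_smul, abs_two]) (isProx_proxReg hβ.le hρ.le (dualArg A xt σ ξ'))
  rw [dualArg_sub, inner_neg_right] at h
  rw [psi_eq A b xt hβ hρ hσ, psi_eq A b xt hβ hρ hσ, gradMap, inner_sub_left, inner_add_left,
    real_inner_smul_left, inner_app, inner_sub_right b, inner_sub_right ξ,
    real_inner_self_eq_norm_sq, norm_sub_sq_real, real_inner_comm ξ ξ']
  nlinarith [mul_le_mul_of_nonneg_left h hσ.le]

theorem psi_quadratic_upper (hβ : 0 < β) (hρ : 0 < ρ) (hσ : 0 < σ) {a : ℝ}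
    (ha : ∀ v, ‖app A.transpose v‖ ≤ a * ‖v‖) (ξ ξ' : Vec m) :
    psi A b β ρ σ xt ξ' ≤ psi A b β ρ σ xt ξ + ⟪gradMap A b xt β ρ σ ξ, ξ' - ξ⟫_ℝ
      + (1 + σ * a ^ 2) / 2 * ‖ξ' - ξ‖ ^ 2 := by
  have h := (isProx_proxReg hβ.le hρ.le (dualArg A xt σ ξ)).half_sq_le
    (fun x => by rw [reg_smul, abs_two]) (isProx_proxReg hβ.le hρ.le (dualArg A xt σ ξ'))
  rw [dualArg_sub, inner_neg_right, norm_neg] at h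
  have h1 : ‖app A.transpose (ξ' - ξ)‖ ^ 2 ≤ a ^ 2 * ‖ξ' - ξ‖ ^ 2 := by
    rw [← mul_pow]
    exact pow_le_pow_left₀ (norm_nonneg _) (ha _) 2
  have h2 : 1 / 2 * ‖ξ'‖ ^ 2 = 1 / 2 * ‖ξ‖ ^ 2 + ⟪ξ, ξ' - ξ⟫_ℝ + 1 / 2 * ‖ξ' - ξ‖ ^ 2 := by
    have := norm_add_sq_real ξ (ξ' - ξ)
    rw [add_sub_cancel] at this
    linarith
  rw [psi_eq A b xt hβ hρ hσ, psi_eq A b xt hβ hρ hσ, h2, gradMap, inner_sub_left,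
    inner_add_left, real_inner_smul_left, inner_app, inner_sub_right b]
  have h3 := mul_le_mul_of_nonneg_left h hσ.le
  have h4 := mul_le_mul_of_nonneg_left h1 hσ.le
  linarith

theorem gradMap_lipschitz (hβ : 0 < β) (hρ : 0 < ρ) (hσ : 0 < σ) {a : ℝ} (ha0 : 0 ≤ a)
    (haA : ∀ v, ‖app A v‖ ≤ a * ‖v‖) (ha : ∀ v, ‖app A.transpose v‖ ≤ a * ‖v‖)
    (ξ ξ' : Vec m) : ‖gradMap A b xt β ρ σ ξ' - gradMap A b xt β ρ σ ξ‖
      ≤ (1 + σ * a ^ 2) * ‖ξ' - ξ‖ := by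
  have e : gradMap A b xt β ρ σ ξ' - gradMap A b xt β ρ σ ξ = (ξ' - ξ)
      - σ • app A (proxReg β ρ (dualArg A xt σ ξ') - proxReg β ρ (dualArg A xt σ ξ)) := by
    rw [gradMap, gradMap, app_sub, smul_sub]
    abel
  have h := norm_proxReg_sub_le hβ.le hρ.le (dualArg A xt σ ξ) (dualArg A xt σ ξ')
  rw [dualArg_sub, norm_neg] at h
  have h1 := (haA _).trans (mul_le_mul_of_nonneg_left (h.trans (ha _)) ha0)
  rw [e]
  refine (norm_sub_le _ _).trans ?_
  rw [norm_smul, Real.norm_of_nonneg hσ.le]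
  linarith [mul_le_mul_of_nonneg_left h1 hσ.le]

theorem exists_common_bound : ∃ a : ℝ, 0 ≤ a ∧ (∀ v, ‖app A v‖ ≤ a * ‖v‖) ∧
    ∀ v, ‖app A.transpose v‖ ≤ a * ‖v‖ := by
  obtain ⟨a, ha, hA⟩ := exists_app_bound A
  obtain ⟨c, hc, hC⟩ := exists_app_bound A.transpose
  refine ⟨max a c, le_max_of_le_left ha, fun v => (hA v).trans ?_, fun v => (hC v).trans ?_⟩
  · exact mul_le_mul_of_nonneg_right (le_max_left _ _) (norm_nonneg _)
  · exact mul_le_mul_of_nonneg_right (le_max_right _ _) (norm_nonneg _)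

theorem hasGradientAt_psi (hβ : 0 < β) (hρ : 0 < ρ) (hσ : 0 < σ) (ξ : Vec m) :
    HasGradientAt (psi A b β ρ σ xt) (gradMap A b xt β ρ σ ξ) ξ := by
  obtain ⟨a, -, -, ha⟩ := exists_common_bound A
  rw [hasGradientAt_iff_isLittleO]
  have h : (fun ξ' => psi A b β ρ σ xt ξ' - psi A b β ρ σ xt ξ
      - ⟪gradMap A b xt β ρ σ ξ, ξ' - ξ⟫_ℝ) =O[𝓝 ξ] fun ξ' => ‖ξ' - ξ‖ ^ 2 := by
    refine Asymptotics.IsBigO.of_bound ((1 + σ * a ^ 2) / 2) (Eventually.of_forall fun ξ' => ?_)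
    have h1 := psi_quadratic_lower A b xt hβ hρ hσ ξ ξ'
    have h2 := psi_quadratic_upper A b xt hβ hρ hσ ha ξ ξ'
    rw [Real.norm_eq_abs, Real.norm_of_nonneg (by positivity), abs_of_nonneg]
    · linarith
    · linarith [sq_nonneg ‖ξ' - ξ‖]
  refine h.trans_isLittleO ?_
  have h3 : Tendsto (fun ξ' : Vec m => ‖ξ' - ξ‖) (𝓝 ξ) (𝓝 0) := by
    have : Continuous fun ξ' : Vec m => ‖ξ' - ξ‖ := by fun_prop
    simpa using this.tendsto ξ
  rw [← Asymptotics.isLittleO_norm_right]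
  simpa only [pow_two, one_mul] using
    ((Asymptotics.isLittleO_one_iff ℝ).2 h3).mul_isBigO (Asymptotics.isBigO_refl _ (𝓝 ξ))

theorem gradient_psi (hβ : 0 < β) (hρ : 0 < ρ) (hσ : 0 < σ) :
    gradient (psi A b β ρ σ xt) = gradMap A b xt β ρ σ :=
  funext fun ξ => (hasGradientAt_psi A b xt hβ hρ hσ ξ).gradient

theorem continuous_gradMap (hβ : 0 < β) (hρ : 0 < ρ) (hσ : 0 < σ) :
    Continuous (gradMap A b xt β ρ σ) := by
  obtain ⟨a, ha0, haA, ha⟩ := exists_common_bound A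
  refine LipschitzWith.continuous (K := (1 + σ * a ^ 2).toNNReal)
    (LipschitzWith.of_dist_le_mul fun ξ' ξ => ?_)
  rw [dist_eq_norm, dist_eq_norm, Real.coe_toNNReal _ (by positivity)]
  exact gradMap_lipschitz A b xt hβ hρ hσ ha0 haA ha ξ ξ'

theorem contDiff_psi (hβ : 0 < β) (hρ : 0 < ρ) (hσ : 0 < σ) :
    ContDiff ℝ 1 (psi A b β ρ σ xt) := by
  refine contDiff_one_iff_fderiv.2
    ⟨fun ξ => (hasGradientAt_psi A b xt hβ hρ hσ ξ).differentiableAt, ?_⟩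
  have : fderiv ℝ (psi A b β ρ σ xt)
      = fun ξ => InnerProductSpace.toDual ℝ (Vec m) (gradMap A b xt β ρ σ ξ) :=
    funext fun ξ => (hasGradientAt_psi A b xt hβ hρ hσ ξ).hasFDerivAt.fderiv
  rw [this]
  exact (InnerProductSpace.toDual ℝ (Vec m)).continuous.comp
    (continuous_gradMap A b xt hβ hρ hσ)

/-! ### The matrices in `V(ξ)` -/

theorem inner_app_self_of_mem_jacProx (hρ : 0 < ρ) {y : Vec n} {M : Matrix (Fin n) (Fin n) ℝ}
    (hM : M ∈ jacProx β ρ y) (v : Vec n) : ⟪app M v, v⟫_ℝ = ‖app M v‖ ^ 2 := by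
  rw [← real_inner_self_eq_norm_sq, inner_app M v (app M v), hM.1.eq, ← app_mul,
    mul_self_of_mem_jacProx hρ.le hM, real_inner_comm]

theorem norm_app_le_of_mem_jacProx (hρ : 0 < ρ) {y : Vec n} {M : Matrix (Fin n) (Fin n) ℝ}
    (hM : M ∈ jacProx β ρ y) (v : Vec n) : ‖app M v‖ ≤ ‖v‖ := by
  have h := inner_app_self_of_mem_jacProx hρ hM v
  have h1 := real_inner_le_norm (app M v) v
  by_contra! hlt
  nlinarith [norm_nonneg v]

theorem app_jacGrad {M : Matrix (Fin n) (Fin n) ℝ} (v : Vec m) :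
    app (1 + σ • (A * M * A.transpose)) v = v + σ • app A (app M (app A.transpose v)) := by
  rw [app_add_left, app_one, app_smul_left, app_mul, app_mul]

variable {A xt} in
theorem inner_app_comm_of_mem_jacGrad {ξ : Vec m} {V : Matrix (Fin m) (Fin m) ℝ}
    (hV : V ∈ jacGrad A β ρ σ xt ξ) (v w : Vec m) : ⟪app V v, w⟫_ℝ = ⟪v, app V w⟫_ℝ := by
  obtain ⟨M, hM, rfl⟩ := hV
  rw [app_jacGrad, app_jacGrad, inner_add_left, inner_add_right, real_inner_smul_left,
    real_inner_smul_right, inner_app, inner_app, inner_app, hM.1.eq, Matrix.transpose_transpose]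

variable {A xt} in
theorem sq_norm_le_inner_of_mem_jacGrad (hρ : 0 < ρ) (hσ : 0 < σ) {ξ : Vec m}
    {V : Matrix (Fin m) (Fin m) ℝ} (hV : V ∈ jacGrad A β ρ σ xt ξ) (v : Vec m) :
    ‖v‖ ^ 2 ≤ ⟪app V v, v⟫_ℝ := by
  obtain ⟨M, hM, rfl⟩ := hV
  rw [app_jacGrad, inner_add_left, real_inner_smul_left, inner_app,
    inner_app_self_of_mem_jacProx hρ hM, real_inner_self_eq_norm_sq]
  have : 0 ≤ σ * ‖app M (app A.transpose v)‖ ^ 2 := by positivity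
  linarith

variable {A xt} in
theorem norm_app_le_of_mem_jacGrad (hρ : 0 < ρ) (hσ : 0 < σ) {a : ℝ} (ha0 : 0 ≤ a)
    (haA : ∀ v, ‖app A v‖ ≤ a * ‖v‖) (ha : ∀ v, ‖app A.transpose v‖ ≤ a * ‖v‖) {ξ : Vec m}
    {V : Matrix (Fin m) (Fin m) ℝ} (hV : V ∈ jacGrad A β ρ σ xt ξ) (v : Vec m) :
    ‖app V v‖ ≤ (1 + σ * a ^ 2) * ‖v‖ := by
  obtain ⟨M, hM, rfl⟩ := hV
  rw [app_jacGrad]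
  refine (norm_add_le _ _).trans ?_
  rw [norm_smul, Real.norm_of_nonneg hσ.le]
  have h1 := (haA (app M (app A.transpose v))).trans (mul_le_mul_of_nonneg_left
    ((norm_app_le_of_mem_jacProx hρ hM _).trans (ha v)) ha0)
  linarith [mul_le_mul_of_nonneg_left h1 hσ.le]

/-- Near `ξ'` the gradient of `ψ` is exactly linearized by every matrix in `V(ξ)`, and the
trapezoidal rule for `ψ` is exact. -/
theorem eventually_jacGrad (hβ : 0 < β) (hρ : 0 < ρ) (hσ : 0 < σ) (ξ' : Vec m) :
    ∀ᶠ ξ in 𝓝 ξ', ∀ V ∈ jacGrad A β ρ σ xt ξ,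
      gradMap A b xt β ρ σ ξ - gradMap A b xt β ρ σ ξ' = app V (ξ - ξ') ∧
      psi A b β ρ σ xt ξ - psi A b β ρ σ xt ξ'
        = 1 / 2 * ⟪gradMap A b xt β ρ σ ξ + gradMap A b xt β ρ σ ξ', ξ - ξ'⟫_ℝ := by
  have hc : Continuous (dualArg A xt σ) := continuous_const.sub (continuous_app _)
  filter_upwards [hc.continuousAt.eventually
    (eventually_proxReg_sub hβ hρ.le (dualArg A xt σ ξ'))] with ξ hξ V hV
  obtain ⟨M, hM, rfl⟩ := hV
  have h := hξ M hM
  have hfix := app_proxReg_of_mem_jacProx hρ.le hM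
  have hidem := mul_self_of_mem_jacProx hρ.le hM
  change app M (proxReg β ρ (dualArg A xt σ ξ)) = proxReg β ρ (dualArg A xt σ ξ) at hfix
  rw [psi_eq A b xt hβ hρ hσ, psi_eq A b xt hβ hρ hσ, gradMap, gradMap, app_jacGrad]
  have hd := dualArg_sub A xt (σ := σ) ξ' ξ
  set x := proxReg β ρ (dualArg A xt σ ξ)
  set x' := proxReg β ρ (dualArg A xt σ ξ')
  set d := app A.transpose (ξ - ξ') with hddef
  rw [hd] at h
  have hM0 : app M (-d) = -app M d := by
    rw [← neg_one_smul ℝ d, app_smul, neg_one_smul]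
  constructor
  · have : app M d = -(x - x') := by rw [h, hM0, neg_neg]
    rw [this, ← neg_one_smul ℝ (x - x'), app_smul, neg_one_smul, app_sub, smul_neg, smul_sub]
    abel
  -- M fixes x and its own range, and x - x' = M(-d); so M also fixes x'. Then ‖x‖² - ‖x'‖² =
  -- ⟨M(-d), x + x'⟩ = -⟨d, x + x'⟩.
  · have hfix' : app M (x + x') = x + x' := by
      have hx' : x' = x - app M (-d) := by rw [← h]; abel
      rw [app_add, hx', app_sub, ← app_mul, hidem, hfix]
    have h1 : ‖x‖ ^ 2 - ‖x'‖ ^ 2 = -⟪app A (x + x'), ξ - ξ'⟫_ℝ := by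
      rw [inner_app, ← hddef, ← inner_neg_right, ← hfix', inner_app, hM.1.eq, ← h,
        inner_add_left, inner_sub_right, inner_sub_right, real_inner_self_eq_norm_sq,
        real_inner_self_eq_norm_sq, real_inner_comm]
      ring
    have h2 : ξ + b - σ • app A x + (ξ' + b - σ • app A x')
        = (ξ + ξ') + (b + b) - σ • app A (x + x') := by
      rw [app_add, smul_add]; abel
    rw [h2, inner_sub_left, inner_add_left, real_inner_smul_left, inner_add_left b,
      inner_add_left ξ, inner_sub_right b, inner_sub_right ξ, inner_sub_right ξ',
      real_inner_self_eq_norm_sq, real_inner_self_eq_norm_sq, real_inner_comm ξ ξ']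
    linear_combination (σ / 2) * h1

end Dual

/-! ### The conjugate gradient method -/

section CG

variable {m : ℕ}

/-- Invariant of the conjugate gradient method for `V h = c` on states (iterate, residual,
direction): `W` is the space spanned by the previous directions. -/
structure CGInvariant (V : Matrix (Fin m) (Fin m) ℝ) (c : Vec m)
    (s : Vec m × Vec m × Vec m) (W : Submodule ℝ (Vec m)) : Prop where
  iterate_mem : s.1 ∈ W
  residual_eq : s.2.1 = c - app V s.1
  residual_orthogonal : ∀ w ∈ W, ⟪s.2.1, w⟫_ℝ = 0
  direction_conjugate : ∀ w ∈ W, ⟪s.2.2, app V w⟫_ℝ = 0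
  app_mem : ∀ w ∈ W, app V w ∈ W ⊔ Submodule.span ℝ {s.2.2}
  residual_mem : s.2.1 ∈ W ⊔ Submodule.span ℝ {s.2.2}
  rhs_mem : c ∈ W ⊔ Submodule.span ℝ {s.2.2}

variable {V : Matrix (Fin m) (Fin m) ℝ} {c : Vec m}

theorem mem_sup_span_singleton {W : Submodule ℝ (Vec m)} {p v : Vec m} :
    v ∈ W ⊔ Submodule.span ℝ {p} ↔ ∃ w ∈ W, ∃ t : ℝ, v = w + t • p := by
  rw [Submodule.mem_sup]
  constructor
  · rintro ⟨w, hw, z, hz, rfl⟩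
    obtain ⟨t, rfl⟩ := Submodule.mem_span_singleton.1 hz
    exact ⟨w, hw, t, rfl⟩
  · rintro ⟨w, hw, t, rfl⟩
    exact ⟨w, hw, _, Submodule.mem_span_singleton.2 ⟨t, rfl⟩, rfl⟩

/-- By ⟨r,p⟩ = ⟨r,r⟩ the step length is that of exact line search, so r' ⊥ p; conjugacy keeps r' ⊥
W. Since V maps W into W + span p, r' is also orthogonal to VW, so conjugacy of p' needs checking
only against Vp = a⁻¹(r - r'). -/
theorem CGInvariant.step (hsymm : ∀ v w, ⟪app V v, w⟫_ℝ = ⟪v, app V w⟫_ℝ)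
    (hpos : ∀ v, ‖v‖ ^ 2 ≤ ⟪app V v, v⟫_ℝ) {s : Vec m × Vec m × Vec m}
    {W : Submodule ℝ (Vec m)} (h : CGInvariant V c s W) (hr : s.2.1 ≠ 0)
    (hrp : ⟪s.2.1, s.2.2⟫_ℝ = ⟪s.2.1, s.2.1⟫_ℝ) :
    CGInvariant V c (cgStep V s) (W ⊔ Submodule.span ℝ {s.2.2}) ∧
      ⟪(cgStep V s).2.1, (cgStep V s).2.2⟫_ℝ = ⟪(cgStep V s).2.1, (cgStep V s).2.1⟫_ℝ := by
  obtain ⟨x, r, p⟩ := s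
  obtain ⟨hx, hres, hro, hpc, hVm, hrm, hcm⟩ := h
  simp only at *
  have hrr : 0 < ⟪r, r⟫_ℝ := real_inner_self_pos.2 hr
  have hp : p ≠ 0 := by
    rintro rfl
    rw [inner_zero_right] at hrp
    exact hrr.ne hrp
  have hpp : 0 < ⟪p, app V p⟫_ℝ := by
    have := hpos p
    rw [hsymm] at this
    have h0 := norm_pos_iff.2 hp
    nlinarith
  set a := ⟪r, r⟫_ℝ / ⟪p, app V p⟫_ℝ with ha
  have ha0 : 0 < a := div_pos hrr hpp
  have hap : a * ⟪p, app V p⟫_ℝ = ⟪r, r⟫_ℝ := div_mul_cancel₀ _ hpp.ne'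
  set r' := r - a • app V p with hr'
  set t := ⟪r', r'⟫_ℝ / ⟪r, r⟫_ℝ with ht
  have htr : t * ⟪r, r⟫_ℝ = ⟪r', r'⟫_ℝ := div_mul_cancel₀ _ hrr.ne'
  set p' := r' + t • p with hp'
  have hstep : cgStep V (x, r, p) = (x + a • p, r', p') := rfl
  rw [hstep]
  set W' := W ⊔ Submodule.span ℝ {p} with hW'
  have hpW : p ∈ W' := mem_sup_span_singleton.2 ⟨0, W.zero_mem, 1, by simp⟩
  have hWW : W ≤ W' := le_sup_left
  have hWW' : W' ≤ W' ⊔ Submodule.span ℝ {p'} := le_sup_left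
  have hpW' : p' ∈ W' ⊔ Submodule.span ℝ {p'} :=
    mem_sup_span_singleton.2 ⟨0, W'.zero_mem, 1, by simp⟩
  have hr'p : ⟪r', p⟫_ℝ = 0 := by
    rw [hr', inner_sub_left, real_inner_smul_left, hrp, hsymm, hap, sub_self]
  have hro' : ∀ w ∈ W', ⟪r', w⟫_ℝ = 0 := by
    intro w hw
    obtain ⟨u, hu, q, rfl⟩ := mem_sup_span_singleton.1 hw
    rw [inner_add_right, inner_smul_right, hr'p, mul_zero, add_zero, hr', inner_sub_left,
      real_inner_smul_left, hro u hu, hsymm, hpc u hu, mul_zero, sub_zero]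
  have hr'r : ⟪r', r⟫_ℝ = 0 := hro' r hrm
  have hVp : app V p = a⁻¹ • (r - r') := by
    rw [hr', sub_sub_cancel, smul_smul, inv_mul_cancel₀ ha0.ne', one_smul]
  have hr'W : r' ∈ W' ⊔ Submodule.span ℝ {p'} := by
    have : r' = p' - t • p := by rw [hp']; abel
    rw [this]
    exact Submodule.sub_mem _ hpW' (Submodule.smul_mem _ _ (hWW' hpW))
  refine ⟨⟨?_, ?_, hro', ?_, ?_, hr'W, hWW' hcm⟩, ?_⟩
  · exact Submodule.add_mem _ (hWW hx) (Submodule.smul_mem _ _ hpW)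
  · simp only [hr', hres, app_add, app_smul]
    abel
  · intro w hw
    obtain ⟨u, hu, q, rfl⟩ := mem_sup_span_singleton.1 hw
    have h1 : ⟪p', app V u⟫_ℝ = 0 := by
      rw [hp', inner_add_left, real_inner_smul_left, hpc u hu, hro' _ (hVm u hu), mul_zero,
        add_zero]
    have h2 : ⟪p', app V p⟫_ℝ = 0 := by
      have h3 : ⟪r', app V p⟫_ℝ = -(a⁻¹ * ⟪r', r'⟫_ℝ) := by
        rw [hVp, inner_smul_right, inner_sub_right, hr'r, zero_sub, mul_neg]
      rw [hp', inner_add_left, real_inner_smul_left, h3, ← htr, ← hap]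
      field_simp
      ring
    simp only [app_add, app_smul, inner_add_right, inner_smul_right, h1, h2, mul_zero, add_zero]
  · intro w hw
    obtain ⟨u, hu, q, rfl⟩ := mem_sup_span_singleton.1 hw
    rw [app_add, app_smul]
    refine Submodule.add_mem _ (hWW' (hVm u hu)) (Submodule.smul_mem _ _ ?_)
    rw [hVp]
    exact Submodule.smul_mem _ _ (Submodule.sub_mem _ (hWW' hrm) hr'W)
  · simp only [hp']
    rw [inner_add_right, inner_smul_right, hr'p, mul_zero, add_zero]

/-- The iterates after the first step satisfy a Galerkin condition on a space that contains
the right-hand side. -/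
theorem exists_galerkin_cgIterate (hsymm : ∀ v w, ⟪app V v, w⟫_ℝ = ⟪v, app V w⟫_ℝ)
    (hpos : ∀ v, ‖v‖ ^ 2 ≤ ⟪app V v, v⟫_ℝ) (k : ℕ) :
    ⟪c - app V (cgIterate V c (k + 1)), cgIterate V c (k + 1)⟫_ℝ = 0 ∧
      ⟪c - app V (cgIterate V c (k + 1)), c⟫_ℝ = 0 := by
  have hzero : ∀ s : Vec m × Vec m × Vec m, s.2.1 = 0 →
      (cgStep V s).1 = s.1 ∧ (cgStep V s).2.1 = 0 := by
    rintro ⟨x, r, p⟩ rfl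
    simp [cgStep]
  -- After the residual vanishes the iterate is frozen and the invariant is dropped. Initially W =
  -- ⊥, so c lies in W only from k = 1 on.
  have hinv : ∀ k : ℕ, ((cgStep V)^[k] (0, c, c)).2.1 = c - app V (cgIterate V c k) ∧
      (((cgStep V)^[k] (0, c, c)).2.1 = 0 ∨
      (⟪((cgStep V)^[k] (0, c, c)).2.1, ((cgStep V)^[k] (0, c, c)).2.2⟫_ℝ
        = ⟪((cgStep V)^[k] (0, c, c)).2.1, ((cgStep V)^[k] (0, c, c)).2.1⟫_ℝ ∧
      ∃ W, CGInvariant V c ((cgStep V)^[k] (0, c, c)) W ∧ (k ≠ 0 → c ∈ W))) := by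
    intro k
    induction k with
    | zero =>
      have hc : c ∈ (⊥ : Submodule ℝ (Vec m)) ⊔ Submodule.span ℝ {c} := by
        rw [bot_sup_eq]; exact Submodule.mem_span_singleton_self c
      refine ⟨by simp [cgIterate, app_zero], Or.inr ⟨rfl, ⊥, ⟨?_, ?_, ?_, ?_, ?_, hc, hc⟩, ?_⟩⟩ <;>
        simp [app_zero]
    | succ k ih =>
      obtain ⟨h1, h2⟩ := ih
      rw [cgIterate, Function.iterate_succ_apply']
      unfold cgIterate at h1
      set s := (cgStep V)^[k] (0, c, c)
      by_cases hr : s.2.1 = 0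
      · obtain ⟨e1, e2⟩ := hzero s hr
        exact ⟨by rw [e1, e2, ← h1, hr], Or.inl e2⟩
      · obtain ⟨hrp, W, hW, -⟩ := h2.resolve_left hr
        obtain ⟨hW', hrp'⟩ := hW.step hsymm hpos hr hrp
        exact ⟨hW'.residual_eq, Or.inr ⟨hrp', _, hW', fun _ => hW.rhs_mem⟩⟩
  obtain ⟨h1, h2⟩ := hinv (k + 1)
  rw [← h1]
  rcases h2 with h2 | ⟨-, W, hW, hc⟩
  · rw [h2, inner_zero_left, inner_zero_left]
    exact ⟨rfl, rfl⟩
  · exact ⟨hW.residual_orthogonal _ hW.iterate_mem,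
      hW.residual_orthogonal _ (hc k.succ_ne_zero)⟩

/-- The properties of a search direction `h` for `V h = c` on which convergence rests. -/
theorem direction_properties (hsymm : ∀ v w, ⟪app V v, w⟫_ℝ = ⟪v, app V w⟫_ℝ)
    (hpos : ∀ v, ‖v‖ ^ 2 ≤ ⟪app V v, v⟫_ℝ) {h : Vec m} {η τ : ℝ} (hη : η < 1) (hτ : 0 < τ)
    (hdir : app V h = c ∨ ∃ k, h = cgIterate V c k)
    (hres : ‖app V h - c‖ ≤ min η (‖c‖ ^ (1 + τ))) :
    ⟪c, h⟫_ℝ = ⟪app V h, h⟫_ℝ ∧ ‖c‖ ≤ ‖app V h‖ := by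
  have hgal : ∀ h : Vec m, ⟪c - app V h, h⟫_ℝ = 0 → ⟪c - app V h, c⟫_ℝ = 0 →
      ⟪c, h⟫_ℝ = ⟪app V h, h⟫_ℝ ∧ ‖c‖ ≤ ‖app V h‖ := by
    intro h h1 h2
    rw [inner_sub_left, sub_eq_zero] at h1 h2
    refine ⟨h1, ?_⟩
    rw [real_inner_self_eq_norm_sq] at h2
    have := real_inner_le_norm (app V h) c
    by_contra! hlt
    nlinarith [norm_nonneg (app V h)]
  rcases hdir with hV | ⟨k, rfl⟩
  · rw [hV]
    exact ⟨rfl, le_rfl⟩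
  · cases k with
    | succ k =>
      obtain ⟨h1, h2⟩ := exists_galerkin_cgIterate (c := c) hsymm hpos k
      exact hgal _ h1 h2
    | zero =>
      have h0 : cgIterate V c 0 = 0 := rfl
      rw [h0, app_zero, zero_sub, norm_neg] at hres
      -- The zero iterate passes the residual test only at a stationary point: otherwise ‖c‖ ≤ η < 1
      -- and τ > 0 give ‖c‖^(1+τ) < ‖c‖.
      have hc : c = 0 := by
        by_contra hc
        have hc' := norm_pos_iff.2 hc
        have h1 : ‖c‖ < 1 := (hres.trans (min_le_left _ _)).trans_lt hη
        have h2 := hres.trans (min_le_right _ _)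
        have h3 := Real.rpow_lt_rpow_of_exponent_gt hc' h1 (by linarith : 1 < 1 + τ)
        rw [Real.rpow_one] at h3
        linarith
      rw [h0, hc]
      simp [app_zero]

end CG

/-! ### Convergence of inexact Newton methods with line search -/

section Newton

variable {E : Type*} [NormedAddCommGroup E] [InnerProductSpace ℝ E] {ψ : E → ℝ} {F : E → E}
  {L : ℝ}

theorem norm_sub_le_of_quadratic_lower
    (hlow : ∀ x y, ψ x + ⟪F x, y - x⟫_ℝ + 1 / 2 * ‖y - x‖ ^ 2 ≤ ψ y) {x y : E} (hy : F y = 0) :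
    ‖x - y‖ ≤ ‖F x‖ := by
  have h1 := hlow x y
  have h2 := hlow y x
  rw [hy, inner_zero_left] at h2
  have h3 := neg_le_of_abs_le (abs_real_inner_le_norm (F x) (y - x))
  rw [norm_sub_rev] at h1 h3
  by_contra! hlt
  nlinarith [norm_nonneg (F x)]

/-- For t ≤ 1/L the quadratic term is at most (t/2)‖h‖² ≤ -(t/2)⟨F x, h⟩, so half of the linear
decrease remains, and μ < 1/2. -/
theorem armijo_of_le (hup : ∀ x y, ψ y ≤ ψ x + ⟪F x, y - x⟫_ℝ + L / 2 * ‖y - x‖ ^ 2)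
    {x h : E} (hd : ⟪F x, h⟫_ℝ ≤ -‖h‖ ^ 2) {μ t : ℝ} (hμ : μ < 1 / 2) (ht : 0 ≤ t)
    (htL : t * L ≤ 1) : ψ (x + t • h) ≤ ψ x + μ * t * ⟪F x, h⟫_ℝ := by
  have h1 := hup x (x + t • h)
  rw [add_sub_cancel_left, inner_smul_right, norm_smul, Real.norm_of_nonneg ht] at h1
  have h2 : L / 2 * (t * ‖h‖) ^ 2 ≤ t * (1 / 2 * ‖h‖ ^ 2) := by
    have : t * L * (t * ‖h‖ ^ 2) ≤ 1 * (t * ‖h‖ ^ 2) :=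
      mul_le_mul_of_nonneg_right htL (by positivity)
    nlinarith
  have h3 : t * ((1 / 2 - μ) * ⟪F x, h⟫_ℝ) ≤ 0 :=
    mul_nonpos_of_nonneg_of_nonpos ht (mul_nonpos_of_nonneg_of_nonpos (by linarith)
      (hd.trans (neg_nonpos.2 (sq_nonneg _))))
  have h4 := mul_le_mul_of_nonneg_left hd ht
  nlinarith

/-- Steps stay at least δ/L, so each decrease of ψ dominates a fixed multiple of ‖ξ j - z‖²; since ψ
is bounded below, these decreases tend to 0. -/
theorem tendsto_of_lineSearch (hL : 1 ≤ L)
    (hlow : ∀ x y, ψ x + ⟪F x, y - x⟫_ℝ + 1 / 2 * ‖y - x‖ ^ 2 ≤ ψ y)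
    (hup : ∀ x y, ψ y ≤ ψ x + ⟪F x, y - x⟫_ℝ + L / 2 * ‖y - x‖ ^ 2)
    {z : E} (hz : F z = 0) {μ δ : ℝ} (hμ0 : 0 < μ) (hμ : μ < 1 / 2) (hδ0 : 0 < δ) (hδ : δ < 1)
    {ξ h : ℕ → E} {e : ℕ → ℕ} (hd : ∀ j, ⟪F (ξ j), h j⟫_ℝ ≤ -‖h j‖ ^ 2)
    (hF : ∀ j, ‖F (ξ j)‖ ≤ L * ‖h j‖)
    (hls : ∀ j, IsLeast {k : ℕ | ψ (ξ j + δ ^ k • h j) ≤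
      ψ (ξ j) + μ * δ ^ k * ⟪F (ξ j), h j⟫_ℝ} (e j))
    (hupd : ∀ j, ξ (j + 1) = ξ j + δ ^ e j • h j) : Tendsto ξ atTop (𝓝 z) := by
  have hL0 : 0 < L := by linarith
  have hstep : ∀ j, δ / L ≤ δ ^ e j := by
    intro j
    rcases hk : e j with _ | k
    · rw [pow_zero, div_le_one hL0]
      linarith
    -- The exponent k, one below the accepted one, was rejected, hence δ^k > 1/L.
    · have hnot : ¬ δ ^ k * L ≤ 1 := fun hle => by
        have := (hls j).2 (armijo_of_le hup (hd j) hμ (pow_nonneg hδ0.le k) hle)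
        omega
      rw [div_le_iff₀ hL0, pow_succ]
      nlinarith
  set κ := μ * (δ / L) / L ^ 2 with hκ
  have hκ0 : 0 < κ := by positivity
  have hdec : ∀ j, κ * ‖ξ j - z‖ ^ 2 ≤ ψ (ξ j) - ψ (ξ (j + 1)) := by
    intro j
    have h1 := (hls j).1
    rw [Set.mem_ofPred_eq, ← hupd] at h1
    have h2 : ‖ξ j - z‖ ^ 2 ≤ L ^ 2 * ‖h j‖ ^ 2 := by
      rw [← mul_pow]
      exact pow_le_pow_left₀ (norm_nonneg _)
        ((norm_sub_le_of_quadratic_lower hlow hz).trans (hF j)) 2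
    have h3 : κ * ‖ξ j - z‖ ^ 2 ≤ μ * (δ / L) * ‖h j‖ ^ 2 := by
      rw [hκ, div_mul_eq_mul_div, div_le_iff₀ (by positivity), mul_assoc _ (‖h j‖ ^ 2),
        mul_comm (‖h j‖ ^ 2)]
      exact mul_le_mul_of_nonneg_left h2 (by positivity)
    have h4 : μ * (δ / L) * ‖h j‖ ^ 2 ≤ μ * δ ^ e j * ‖h j‖ ^ 2 :=
      mul_le_mul_of_nonneg_right (mul_le_mul_of_nonneg_left (hstep j) hμ0.le) (sq_nonneg _)
    have h5 : μ * δ ^ e j * ⟪F (ξ j), h j⟫_ℝ ≤ μ * δ ^ e j * -‖h j‖ ^ 2 :=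
      mul_le_mul_of_nonneg_left (hd j) (by positivity)
    linarith
  have hanti : Antitone fun j => ψ (ξ j) := antitone_nat_of_succ_le fun j => by
    have : 0 ≤ κ * ‖ξ j - z‖ ^ 2 := by positivity
    linarith [hdec j]
  have hbdd : BddBelow (Set.range fun j => ψ (ξ j)) := by
    refine ⟨ψ z, ?_⟩
    rintro _ ⟨j, rfl⟩
    have := hlow z (ξ j)
    rw [hz, inner_zero_left] at this
    have h0 : 0 ≤ 1 / 2 * ‖ξ j - z‖ ^ 2 := by positivity
    simp only
    linarith
  have hlim := tendsto_atTop_ciInf hanti hbdd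
  have hdiff : Tendsto (fun j => (ψ (ξ j) - ψ (ξ (j + 1))) / κ) atTop (𝓝 0) := by
    simpa using (hlim.sub (hlim.comp (tendsto_add_atTop_nat 1))).div_const κ
  have hsq : Tendsto (fun j => ‖ξ j - z‖ ^ 2) atTop (𝓝 0) := by
    refine squeeze_zero (fun j => sq_nonneg _) (fun j => ?_) hdiff
    rw [le_div_iff₀ hκ0, mul_comm]
    exact hdec j
  rw [tendsto_iff_norm_sub_tendsto_zero]
  simpa [Real.sqrt_sq] using hsq.sqrt

theorem superlinear_of_tendsto (hL : 1 ≤ L)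
    (hlow : ∀ x y, ψ x + ⟪F x, y - x⟫_ℝ + 1 / 2 * ‖y - x‖ ^ 2 ≤ ψ y)
    (hup : ∀ x y, ψ y ≤ ψ x + ⟪F x, y - x⟫_ℝ + L / 2 * ‖y - x‖ ^ 2)
    (hlip : ∀ x y, ‖F y - F x‖ ≤ L * ‖y - x‖)
    {z : E} (hz : F z = 0) {μ τ δ : ℝ} (hμ : μ < 1 / 2) (hτ : 0 < τ)
    {ξ h : ℕ → E} {e : ℕ → ℕ} (hd : ∀ j, ⟪F (ξ j), h j⟫_ℝ ≤ -‖h j‖ ^ 2)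
    (hF : ∀ j, ‖F (ξ j)‖ ≤ L * ‖h j‖)
    (hls : ∀ j, IsLeast {k : ℕ | ψ (ξ j + δ ^ k • h j) ≤
      ψ (ξ j) + μ * δ ^ k * ⟪F (ξ j), h j⟫_ℝ} (e j))
    (hupd : ∀ j, ξ (j + 1) = ξ j + δ ^ e j • h j)
    (hnewton : ∀ᶠ j in atTop, ‖ξ j + h j - z‖ ≤ ‖F (ξ j)‖ ^ (1 + τ))
    (htrap : ∀ᶠ j in atTop, ψ (ξ j) - ψ z = 1 / 2 * ⟪F (ξ j), ξ j - z⟫_ℝ)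
    (hlim : Tendsto ξ atTop (𝓝 z)) :
    (fun j => ‖ξ (j + 1) - z‖) =O[atTop] (fun j => ‖ξ j - z‖ ^ (1 + τ)) ∧
      ∀ᶠ j in atTop, e j = 0 ∧ ξ (j + 1) = ξ j + h j := by
  have hL0 : 0 < L := by linarith
  have hFd : ∀ j, ‖F (ξ j)‖ ≤ L * ‖ξ j - z‖ := fun j => by
    simpa [hz] using hlip z (ξ j)
  have hnewton' : ∀ᶠ j in atTop, ‖ξ j + h j - z‖ ≤ L ^ (1 + τ) * ‖ξ j - z‖ ^ (1 + τ) := by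
    filter_upwards [hnewton] with j hj
    refine hj.trans ?_
    rw [← Real.mul_rpow hL0.le (norm_nonneg _)]
    exact Real.rpow_le_rpow (norm_nonneg _) (hFd j) (by linarith)
  have hsmall : Tendsto (fun j => L ^ (1 + τ) * ‖ξ j - z‖ ^ τ) atTop (𝓝 0) := by
    have h1 := tendsto_iff_norm_sub_tendsto_zero.1 hlim
    have h2 := (h1.rpow_const (p := τ) (Or.inr hτ.le)).const_mul (L ^ (1 + τ))
    rwa [Real.zero_rpow hτ.ne', mul_zero] at h2
  -- The errors of the unit step total at most Lε‖ξ j - z‖² ≤ L³ε‖h j‖², which must not exceed the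
  -- slack (1/2 - μ)‖h j‖².
  set ε := (1 / 2 - μ) / L ^ 3 with hε
  have hε0 : 0 < ε := div_pos (by linarith) (by positivity)
  have hunit : ∀ᶠ j in atTop, e j = 0 := by
    filter_upwards [hnewton', htrap, hsmall.eventually (gt_mem_nhds hε0),
      hsmall.eventually (gt_mem_nhds one_pos)] with j hj ht hεj h1j
    have hrp : ‖ξ j - z‖ ^ (1 + τ) = ‖ξ j - z‖ * ‖ξ j - z‖ ^ τ := by
      rw [Real.rpow_add_of_nonneg (norm_nonneg _) zero_le_one hτ.le, Real.rpow_one]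
    rw [hrp] at hj
    have hjd : ‖ξ j + h j - z‖ ≤ L ^ (1 + τ) * ‖ξ j - z‖ ^ τ * ‖ξ j - z‖ := by linarith
    have hjε : ‖ξ j + h j - z‖ ≤ ε * ‖ξ j - z‖ :=
      hjd.trans (mul_le_mul_of_nonneg_right hεj.le (norm_nonneg _))
    have hj1 : ‖ξ j + h j - z‖ ≤ ‖ξ j - z‖ := by
      simpa using hjd.trans (mul_le_mul_of_nonneg_right h1j.le (norm_nonneg _))
    refine Nat.le_zero.1 ((hls j).2 ?_)
    rw [Set.mem_ofPred_eq, pow_zero, one_smul, mul_one]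
    have hA := hup z (ξ j + h j)
    rw [hz, inner_zero_left, add_zero] at hA
    have hB : ⟪F (ξ j), ξ j - z⟫_ℝ = ⟪F (ξ j), ξ j + h j - z⟫_ℝ - ⟪F (ξ j), h j⟫_ℝ := by
      rw [← inner_sub_right]
      congr 1
      abel
    have hC := neg_le_of_abs_le (abs_real_inner_le_norm (F (ξ j)) (ξ j + h j - z))
    have hD : ‖ξ j - z‖ ^ 2 ≤ L ^ 2 * ‖h j‖ ^ 2 := by
      rw [← mul_pow]
      exact pow_le_pow_left₀ (norm_nonneg _)
        ((norm_sub_le_of_quadratic_lower hlow hz).trans (hF j)) 2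
    have hE : L / 2 * ‖ξ j + h j - z‖ ^ 2 ≤ L / 2 * (ε * ‖ξ j - z‖ ^ 2) := by
      refine mul_le_mul_of_nonneg_left ?_ (by linarith)
      calc ‖ξ j + h j - z‖ ^ 2 = ‖ξ j + h j - z‖ * ‖ξ j + h j - z‖ := sq _
        _ ≤ (ε * ‖ξ j - z‖) * ‖ξ j - z‖ := mul_le_mul hjε hj1 (norm_nonneg _) (by positivity)
        _ = ε * ‖ξ j - z‖ ^ 2 := by ring
    have hG : ‖F (ξ j)‖ * ‖ξ j + h j - z‖ ≤ L * (ε * ‖ξ j - z‖ ^ 2) := by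
      calc ‖F (ξ j)‖ * ‖ξ j + h j - z‖ ≤ (L * ‖ξ j - z‖) * (ε * ‖ξ j - z‖) :=
            mul_le_mul (hFd j) hjε (norm_nonneg _) (by positivity)
        _ = L * (ε * ‖ξ j - z‖ ^ 2) := by ring
    have hH : L * (ε * ‖ξ j - z‖ ^ 2) ≤ (1 / 2 - μ) * ‖h j‖ ^ 2 := by
      have : L * (ε * ‖ξ j - z‖ ^ 2) = (1 / 2 - μ) * (‖ξ j - z‖ ^ 2 / L ^ 2) := by
        rw [hε]; field_simp
      rw [this]
      refine mul_le_mul_of_nonneg_left ?_ (by linarith)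
      rw [div_le_iff₀ (by positivity)]
      linarith
    have hI : (1 / 2 - μ) * ⟪F (ξ j), h j⟫_ℝ ≤ (1 / 2 - μ) * -‖h j‖ ^ 2 :=
      mul_le_mul_of_nonneg_left (hd j) (by linarith)
    linarith
  have hfinal : ∀ᶠ j in atTop, e j = 0 ∧ ξ (j + 1) = ξ j + h j := by
    filter_upwards [hunit] with j hj
    refine ⟨hj, ?_⟩
    rw [hupd, hj, pow_zero, one_smul]
  refine ⟨Asymptotics.IsBigO.of_bound (L ^ (1 + τ)) ?_, hfinal⟩
  filter_upwards [hnewton', hfinal] with j hj hj'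
  rw [norm_norm, hj'.2, Real.norm_of_nonneg (by positivity)]
  exact hj

end Newton

/-! ### The semismooth Newton method for the dual problem -/

section Run

variable {m n : ℕ} (A : Matrix (Fin m) (Fin n) ℝ) (b : Vec m) {β ρ σ : ℝ} (xt : Vec n)

theorem exists_minimizer_psi (hβ : 0 < β) (hρ : 0 < ρ) (hσ : 0 < σ) :
    ∃ z, gradMap A b xt β ρ σ z = 0 := by
  have hcont : Continuous (psi A b β ρ σ xt) := (contDiff_psi A b xt hβ hρ hσ).continuous
  have hlim : Tendsto (psi A b β ρ σ xt) (cocompact _) atTop := by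
    set c := ‖gradMap A b xt β ρ σ 0‖ with hc
    -- From ½t² - ct ≥ t - ½(c+1)² with t = ‖ξ‖, a rewriting of (t - (c+1))² ≥ 0.
    have hbound : ∀ ξ : Vec m, ‖ξ‖ + (psi A b β ρ σ xt 0 - 1 / 2 * (c + 1) ^ 2)
        ≤ psi A b β ρ σ xt ξ := fun ξ => by
      have h1 := psi_quadratic_lower A b xt hβ hρ hσ 0 ξ
      rw [sub_zero] at h1
      have h2 := neg_le_of_abs_le (abs_real_inner_le_norm (gradMap A b xt β ρ σ 0) ξ)
      nlinarith [sq_nonneg (‖ξ‖ - (c + 1))]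
    exact tendsto_atTop_mono hbound
      (tendsto_atTop_add_const_right _ _ tendsto_norm_cocompact_atTop)
  obtain ⟨z, hz⟩ := hcont.exists_forall_le hlim
  refine ⟨z, ?_⟩
  have h1 : IsLocalMin (psi A b β ρ σ xt) z := Eventually.of_forall hz
  have h2 := h1.hasFDerivAt_eq_zero (hasGradientAt_psi A b xt hβ hρ hσ z).hasFDerivAt
  exact (InnerProductSpace.toDual ℝ (Vec m)).map_eq_zero_iff.1 h2

theorem IsSsnRun.convergence (hβ : 0 < β) (hρ : 0 < ρ) (hσ : 0 < σ) {z : Vec m}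
    (hz : gradMap A b xt β ρ σ z = 0) {μ η τ δ : ℝ} (hμ0 : 0 < μ) (hμ : μ < 1 / 2)
    (hη : η < 1) (hτ : 0 < τ) (hδ0 : 0 < δ) (hδ : δ < 1) {ξ : ℕ → Vec m}
    {V : ℕ → Matrix (Fin m) (Fin m) ℝ} {h : ℕ → Vec m} {e : ℕ → ℕ}
    (hrun : IsSsnRun A b β ρ σ xt μ η τ δ ξ V h e) :
    Tendsto ξ atTop (𝓝 z) ∧
      (fun j => ‖ξ (j + 1) - z‖) =O[atTop] (fun j => ‖ξ j - z‖ ^ (1 + τ)) ∧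
      ∀ᶠ j in atTop, e j = 0 ∧ ξ (j + 1) = ξ j + h j := by
  obtain ⟨hV, hdir, hres, hls, hupd⟩ := hrun
  rw [gradient_psi A b xt hβ hρ hσ] at hdir hres hls
  obtain ⟨a, ha0, haA, ha⟩ := exists_common_bound A
  have hL : 1 ≤ 1 + σ * a ^ 2 := by
    have : 0 ≤ σ * a ^ 2 := by positivity
    linarith
  have hpos := fun j => sq_norm_le_inner_of_mem_jacGrad hρ hσ (hV j)
  have hprop := fun j => direction_properties (inner_app_comm_of_mem_jacGrad (hV j)) (hpos j)
    hη hτ (hdir j) (by simpa only [sub_neg_eq_add, norm_neg] using hres j)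
  have hd : ∀ j, ⟪gradMap A b xt β ρ σ (ξ j), h j⟫_ℝ ≤ -‖h j‖ ^ 2 := fun j => by
    have h1 := (hprop j).1
    rw [inner_neg_left] at h1
    linarith [hpos j (h j)]
  have hF : ∀ j, ‖gradMap A b xt β ρ σ (ξ j)‖ ≤ (1 + σ * a ^ 2) * ‖h j‖ := fun j => by
    have h1 := (hprop j).2
    rw [norm_neg] at h1
    exact h1.trans (norm_app_le_of_mem_jacGrad hρ hσ ha0 haA ha (hV j) _)
  have hlow := psi_quadratic_lower A b xt hβ hρ hσ
  have hup := psi_quadratic_upper A b xt hβ hρ hσ ha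
  have hlim := tendsto_of_lineSearch hL hlow hup hz hμ0 hμ hδ0 hδ hd hF hls hupd
  have hloc := hlim.eventually (eventually_jacGrad A b xt hβ hρ hσ z)
  refine ⟨hlim, superlinear_of_tendsto hL hlow hup
    (gradMap_lipschitz A b xt hβ hρ hσ ha0 haA ha) hz hμ hτ hd hF hls hupd ?_ ?_ hlim⟩
  · filter_upwards [hloc] with j hj
    have h1 := (hj (V j) (hV j)).1
    rw [hz, sub_zero] at h1
    -- Exact linearization turns the inner residual into V applied to the new error, and ‖v‖ ≤ ‖Vv‖
    -- because V dominates the identity.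
    have h2 : app (V j) (h j) + gradMap A b xt β ρ σ (ξ j) = app (V j) (ξ j + h j - z) := by
      rw [h1, ← app_add]
      congr 1
      abel
    have h3 := (hres j).trans (min_le_right _ _)
    rw [h2] at h3
    refine le_trans ?_ h3
    have h4 := (hpos j (ξ j + h j - z)).trans (real_inner_le_norm _ _)
    by_contra! hlt
    nlinarith [norm_nonneg (app (V j) (ξ j + h j - z))]
  · filter_upwards [hloc] with j hj
    have h1 := (hj (V j) (hV j)).2
    rwa [hz, add_zero] at h1

end Run

end ClusteredLasso

theorem mainTheorem5 {m n : ℕ} (A : Matrix (Fin m) (Fin n) ℝ) (b : EuclideanSpace ℝ (Fin m))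
    (β ρ σ : ℝ) (hβ : 0 < β) (hρ : 0 < ρ) (hσ : 0 < σ) (xt : EuclideanSpace ℝ (Fin n)) :
    ContDiff ℝ 1 (ClusteredLasso.psi A b β ρ σ xt) ∧
    ∃ ξhat : EuclideanSpace ℝ (Fin m),
      (∀ ξ, ξ ≠ ξhat →
        ClusteredLasso.psi A b β ρ σ xt ξhat < ClusteredLasso.psi A b β ρ σ xt ξ) ∧
      (∀ ξ, gradient (ClusteredLasso.psi A b β ρ σ xt) ξ = 0 ↔ ξ = ξhat) ∧
      ∀ μ η τ δ : ℝ, 0 < μ → μ < 1 / 2 → 0 < η → η < 1 → 0 < τ → τ ≤ 1 → 0 < δ → δ < 1 →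
        ∀ (ξ : ℕ → EuclideanSpace ℝ (Fin m)) (V : ℕ → Matrix (Fin m) (Fin m) ℝ)
          (h : ℕ → EuclideanSpace ℝ (Fin m)) (e : ℕ → ℕ),
          ClusteredLasso.IsSsnRun A b β ρ σ xt μ η τ δ ξ V h e →
            Tendsto ξ atTop (𝓝 ξhat) ∧
            (fun j => ‖ξ (j + 1) - ξhat‖) =O[atTop] (fun j => ‖ξ j - ξhat‖ ^ (1 + τ)) ∧
            ∀ᶠ j in atTop, e j = 0 ∧ ξ (j + 1) = ξ j + h j := by
  refine ⟨ClusteredLasso.contDiff_psi A b xt hβ hρ hσ, ?_⟩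
  obtain ⟨z, hz⟩ := ClusteredLasso.exists_minimizer_psi A b xt hβ hρ hσ
  have hlow := ClusteredLasso.psi_quadratic_lower A b xt hβ hρ hσ
  refine ⟨z, fun ξ hξ => ?_, fun ξ => ?_, ?_⟩
  · have h1 := hlow z ξ
    rw [hz, inner_zero_left] at h1
    have h2 : 0 < ‖ξ - z‖ := norm_pos_iff.2 (sub_ne_zero.2 hξ)
    have h3 : 0 < 1 / 2 * ‖ξ - z‖ ^ 2 := by positivity
    linarith
  · rw [ClusteredLasso.gradient_psi A b xt hβ hρ hσ]
    constructor
    · intro h0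
      have h1 := ClusteredLasso.norm_sub_le_of_quadratic_lower hlow (x := ξ) hz
      rw [h0, norm_zero] at h1
      exact sub_eq_zero.1 (norm_le_zero_iff.1 h1)
    · rintro rfl
      exact hz
  · intro μ η τ δ hμ0 hμ _ hη hτ _ hδ0 hδ ξ V h e hrun
    exact hrun.convergence A b xt hβ hρ hσ hz hμ0 hμ hη hτ hδ0 hδ
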